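/- Let $p\ge 1$ and $n\ge 1$ be integers, and let $\{Y_t\}_{t\in\mathbb Z}$ be a stationary, mean-zero Gaussian sequence of random vectors in $\mathbb R^p$ (that is, the vectors $Y_t$ are jointly Gaussian: all finite-dimensional distributions of the sequence are Gaussian). Let $\Sigma_m:=\mathbb E\,Y_1Y_{1+m}^{\mathsf T}$ for $0\le m\le n-1$ be its autocovariance matrices and let $\hat\Sigma_0:=\frac1n\sum_{i=1}^n Y_iY_i^{\mathsf T}$. Write $\|\cdot\|$ for the spectral norm and $\|\cdot\|_*$ for the nuclear norm (the sum of the singular values) of a matrix. Then $\mathbb E\|\hat\Sigma_0-\Sigma_0\|$ is finite and $$ \mathbb E\|\hat\Sigma_0-\Sigma_0\|\le \frac2n\Bigg\{2\Big(\|\Sigma_0\|_*+2\sum_{m=1}^{n-1}\|\Sigma_m\|_*\Big)+\sqrt{2n\|\Sigma_0\|\Big(\|\Sigma_0\|_*+2\sum_{m=1}^{n-1}\|\Sigma_m\|_*\Big)}+\sqrt{2n\Big(\|\Sigma_0\|+2\sum_{m=1}^{n-1}\|\Sigma_m\|\Big)\operatorname{Tr}(\Sigma_0)}\Bigg\}.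 $$ -/

import Mathlib

open MeasureTheory ProbabilityTheory
open scoped Matrix.Norms.L2Operator

/-- A sequence of random vectors indexed by `ℤ` is (strictly) stationary: all its
finite-dimensional distributions are invariant under time shifts. -/
def IsStationarySeq {Ω E : Type*} [MeasurableSpace Ω] [MeasurableSpace E]
    (Y : ℤ → Ω → E) (μ : Measure Ω) : Prop :=
  ∀ (I : Finset ℤ) (h : ℤ),
    IdentDistrib (fun ω (i : I) => Y (i + h) ω) (fun ω (i : I) => Y i ω) μ μ

/-- The lag-`m` autocovariance matrix `Σ_m = E[Y₁ Y₁₊ₘᵀ]` of a mean-zero stationary sequence. -/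
noncomputable def autocov {Ω : Type*} [MeasurableSpace Ω] {p : ℕ}
    (Y : ℤ → Ω → EuclideanSpace ℝ (Fin p)) (μ : Measure Ω) (m : ℕ) :
    Matrix (Fin p) (Fin p) ℝ :=
  Matrix.of fun i j => ∫ ω, Y 1 ω i * Y (1 + (m : ℤ)) ω j ∂μ

/-- The lag-`m` sample autocovariance matrix
`(n - m)⁻¹ ∑_{i=1}^{n-m} Yᵢ Yᵢ₊ₘᵀ` of the observations `Y₁, …, Yₙ` (for `m < n`). -/
noncomputable def sampleAutocov {Ω : Type*} {p : ℕ}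
    (Y : ℤ → Ω → EuclideanSpace ℝ (Fin p)) (n m : ℕ) (ω : Ω) :
    Matrix (Fin p) (Fin p) ℝ :=
  ((n : ℝ) - (m : ℝ))⁻¹ • ∑ i ∈ Finset.Icc 1 (n - m),
    Matrix.vecMulVec (Y (i : ℤ) ω).ofLp (Y ((i : ℤ) + (m : ℤ)) ω).ofLp

/-- The nuclear norm of a real square matrix: the sum of its singular values. -/
noncomputable def nuclearNorm {p : ℕ} (A : Matrix (Fin p) (Fin p) ℝ) : ℝ :=
  ∑ i : Fin p, (Matrix.toEuclideanLin A).singularValues i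

/-! Stack the sample as y = (Y₁, …, Yₙ) and let S(y) = ∑ yᵢ ⊗ yᵢ, so that n times the sample
covariance is S(y). Comparing with an independent copy (Jensen) and rotating the pair by π/4 turns
E‖S − ES‖ into at most E‖∑ (yᵢ ⊗ zᵢ + zᵢ ⊗ yᵢ)‖ with z an independent copy of y
(`integral_norm_crossOp_sub_integral_le`). This norm is 2 sup |∑ ⟨yᵢ, v⟩⟨zᵢ, v⟩| over unit v, and
for fixed y the sum is a Gaussian process in v.

Serial dependence enters only through a domination of quadratic forms: Var ∑ ⟨wᵢ, zᵢ⟩ ≤ ∑ ‖L wᵢ‖²,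
the same L for every i. Factoring each Σ_m by its singular value decomposition and applying AM-GM to
each pair of times gives such an L, with squared Hilbert–Schmidt norm at most A = ‖Σ₀‖_* + 2∑‖Σ_m‖_*
and squared operator norm at most B = ‖Σ₀‖ + 2∑‖Σ_m‖ (`exists_dominating_vectors`).

The increments are then those of tensors aᵢ ⊗ bᵢ, so the Sudakov–Fernique inequality (Gaussian
interpolation and integration by parts) gives a Chevet-type comparison with two independent standard
Gaussian vectors, whose supremum is at most the norm of one explicit random vector
(`comparison_le_sqrt`). Taking second moments bounds the conditional expectation by a function of
‖S(y)‖ and ∑‖yᵢ‖².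

Averaging over y brings back E‖S‖ ≤ n‖Σ₀‖ + E‖S − ES‖, so the deviation bounds itself.
`le_of_self_bound` solves this inequality; its side condition becomes B ≤ 2n‖Σ₀‖, which follows from
‖Σ_m‖ ≤ ‖Σ₀‖. -/

theorem MeasureTheory.Integrable.fun_sub {Ω : Type*} [MeasurableSpace Ω] {P : Measure Ω}
    {f g : Ω → ℝ} (hf : Integrable f P) (hg : Integrable g P) :
    Integrable (fun ω => f ω - g ω) P := hf.sub hg

/-! ### Gaussian integration by parts. -/

/-- **Stein's identity** for a centred real Gaussian measure. -/
theorem integral_id_mul_gaussianReal (v : NNReal) {g g' : ℝ → ℝ}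
    (hg : ∀ x, HasDerivAt g (g' x) x) {C C' : ℝ} (hC : ∀ x, |g x| ≤ C) (hC' : ∀ x, |g' x| ≤ C') :
    ∫ x, x * g x ∂gaussianReal 0 v = v * ∫ x, g' x ∂gaussianReal 0 v := by
  by_cases hv : v = 0
  · simp [hv]
  have hv' : (v : ℝ) ≠ 0 := by exact_mod_cast hv
  have hgc : Continuous g := continuous_iff_continuousAt.2 fun x => (hg x).continuousAt
  have hgm : Measurable g' := by
    have : g' = deriv g := funext fun x => (hg x).deriv.symm
    rw [this]; exact measurable_deriv g
  have hpdf : ∀ x, HasDerivAt (gaussianPDFReal 0 v) (-(x / v) * gaussianPDFReal 0 v x) x := by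
    intro x
    rw [gaussianPDFReal_def]
    have h1 : HasDerivAt (fun x : ℝ => -(x - 0) ^ 2 / (2 * (v : ℝ))) (-(x / v)) x := by
      have := (((hasDerivAt_id x).sub_const 0).pow 2).neg.div_const (2 * (v : ℝ))
      refine this.congr_deriv ?_
      simp only [id_eq, Nat.cast_ofNat, Nat.add_one_sub_one, pow_one, mul_one, sub_zero]
      field_simp
    exact (h1.exp.const_mul (√(2 * Real.pi * v))⁻¹).congr_deriv (by ring)
  have hint : Integrable (fun x => x * gaussianPDFReal 0 v x) := by
    have := (memLp_id_gaussianReal (μ := 0) (v := v) 1).integrable le_rfl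
    rw [gaussianReal_of_var_ne_zero _ hv, gaussianPDF_def] at this
    rw [integrable_withDensity_iff_integrable_smul₀' (by fun_prop) (by simp)] at this
    simpa [ENNReal.toReal_ofReal (gaussianPDFReal_nonneg 0 v _), mul_comm] using this
  have hpi := integrable_gaussianPDFReal 0 v
  have key := integral_mul_deriv_eq_deriv_mul_of_integrable (u := g) (u' := g')
    (v := gaussianPDFReal 0 v) (v' := fun x => -(x / v) * gaussianPDFReal 0 v x)
    (fun x _ => hg x) (fun x _ => hpdf x)
    (by
      have := (hint.const_mul (-(v : ℝ)⁻¹)).bdd_mul (c := C) (f := g)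
        hgc.aestronglyMeasurable (.of_forall hC)
      refine this.congr (.of_forall fun x => ?_)
      simp only [Pi.mul_apply]; ring)
    (hpi.bdd_mul (c := C') hgm.aestronglyMeasurable (.of_forall hC'))
    (hpi.bdd_mul (c := C) hgc.aestronglyMeasurable (.of_forall hC))
  rw [integral_gaussianReal_eq_integral_smul hv, integral_gaussianReal_eq_integral_smul hv]
  have h1 : ∫ x, gaussianPDFReal 0 v x • (x * g x)
      = -(v : ℝ) * ∫ x, g x * (-(x / v) * gaussianPDFReal 0 v x) := by
    rw [← integral_const_mul]
    congr 1; ext x; simp; field_simp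
  rw [h1, key, neg_mul_neg]
  congr 2; ext x; simp [mul_comm]

/-- **Gaussian integration by parts**: for jointly Gaussian `(V, U)` with `V` centred,
`E[V f(U)]` is the mean of the derivative of `f` in the direction `(E[V Uᵢ])ᵢ`. -/
theorem ProbabilityTheory.HasGaussianLaw.integral_mul_comp {Ω ι : Type*} [MeasurableSpace Ω]
    [Fintype ι] {P : Measure Ω} {V : Ω → ℝ} {U : Ω → ι → ℝ}
    (h : HasGaussianLaw (fun ω => (V ω, U ω)) P) (hV : ∫ ω, V ω ∂P = 0)
    {c : ι → ℝ} (hc : ∀ i, ∫ ω, V ω * U ω i ∂P = c i) {f f' : (ι → ℝ) → ℝ}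
    (hf : Measurable f) (hf' : Measurable f')
    (hd : ∀ x t, HasDerivAt (fun t : ℝ => f (x + t • c)) (f' (x + t • c)) t)
    {C C' : ℝ} (hC : ∀ x, |f x| ≤ C) (hC' : ∀ x, |f' x| ≤ C') :
    ∫ ω, V ω * f (U ω) ∂P = ∫ ω, f' (U ω) ∂P := by
  have := h.isProbabilityMeasure
  have hVL : MemLp V 2 P := h.fst.memLp_two
  have hUL : ∀ i, MemLp (fun ω => U ω i) 2 P := fun i => (h.snd.eval i).memLp_two
  have hVm : AEMeasurable V P := h.fst.aemeasurable
  have hUm : AEMeasurable U P := h.snd.aemeasurable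
  set s : ℝ := Var[V; P] with hs
  have hs2 : s = ∫ ω, V ω ^ 2 ∂P := by rw [hs, variance_eq_integral hVm, hV]; simp
  -- If V vanishes almost surely then c = 0, so differentiating along c forces f' = 0 and both sides
  -- are zero.
  by_cases hs0 : s = 0
  · have hV0 : V =ᵐ[P] 0 := by
      have h0 : ∫ ω, V ω ^ 2 ∂P = 0 := by rw [← hs2, hs0]
      rw [integral_eq_zero_iff_of_nonneg (fun ω => sq_nonneg _) hVL.integrable_sq] at h0
      filter_upwards [h0] with ω hω
      simpa using hω
    have hc0 : c = 0 := by
      ext i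
      rw [← hc i]
      exact integral_eq_zero_of_ae (by filter_upwards [hV0] with ω hω; simp [hω])
    have hf0 : ∀ x, f' x = 0 := by
      intro x
      have := hd x 0
      simp only [hc0, smul_zero, add_zero] at this
      exact this.unique (hasDerivAt_const _ _)
    simp only [hf0, integral_zero]
    exact integral_eq_zero_of_ae (by filter_upwards [hV0] with ω hω; simp [hω])
  -- R is the residual of the regression of U on V. It is uncorrelated with V, hence independent by
  -- joint Gaussianity, so with R frozen the claim is the one-dimensional Stein identity along the
  -- line r + (x/s) c.
  set R : Ω → ι → ℝ := fun ω => U ω - (V ω / s) • c with hR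
  have hVR : HasGaussianLaw (fun ω => (V ω, R ω)) P := by
    let L : ℝ × (ι → ℝ) →L[ℝ] ℝ × (ι → ℝ) :=
      (ContinuousLinearMap.fst ℝ ℝ (ι → ℝ)).prod
        (ContinuousLinearMap.snd ℝ ℝ (ι → ℝ)
          - s⁻¹ • (ContinuousLinearMap.fst ℝ ℝ (ι → ℝ)).smulRight c)
    have := h.map_fun L
    refine this.congr (.of_forall fun ω => ?_)
    simp [L, hR, div_eq_inv_mul, smul_smul]
  have hRi : ∀ i, MemLp (fun ω => R ω i) 2 P := fun i => (hVR.snd.eval i).memLp_two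
  have hind : IndepFun V R P := by
    have h1 : IndepFun (fun ω (_ : Unit) => V ω) R P := by
      refine HasGaussianLaw.indepFun_of_covariance_eval (X := fun (_ : Unit) => V)
        (Y := fun i ω => R ω i) ?_ ?_
      · let L : ℝ × (ι → ℝ) →L[ℝ] (Unit → ℝ) × (ι → ℝ) :=
          (ContinuousLinearMap.pi fun _ => ContinuousLinearMap.fst ℝ ℝ (ι → ℝ)).prod
            (ContinuousLinearMap.snd ℝ ℝ (ι → ℝ))
        exact hVR.map_fun L
      · intro _ i
        rw [covariance_eq_sub hVL (hRi i), hV, zero_mul, sub_zero]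
        have : (V * fun ω => R ω i) = fun ω => V ω * U ω i - (c i / s) * V ω ^ 2 := by
          ext ω; simp [hR]; ring
        rw [this]
        have hs' := integral_sub (f := fun ω => V ω * U ω i) (g := fun ω => (c i / s) * V ω ^ 2)
          (hVL.integrable_mul (hUL i)) (hVL.integrable_sq.const_mul _)
        rw [hs', hc, integral_const_mul, ← hs2]
        field_simp; ring
    exact h1.comp (φ := fun g => g ()) (ψ := id) (measurable_pi_apply (X := fun _ : Unit => ℝ) ()) measurable_id
  have hmap := (indepFun_iff_map_prod_eq_prod_map_map hVm hVR.snd.aemeasurable).1 hind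
  have hVmap : P.map V = gaussianReal 0 s.toNNReal := by
    rw [h.fst.map_eq_gaussianReal, hV]
  have hUR : ∀ ω, U ω = R ω + (V ω / s) • c := fun ω => by simp [hR]
  have hprob : IsProbabilityMeasure (P.map R) :=
    Measure.isProbabilityMeasure_map hVR.snd.aemeasurable
  have hprobV : IsProbabilityMeasure (P.map V) := Measure.isProbabilityMeasure_map hVm
  have hpair : AEMeasurable (fun ω => (V ω, R ω)) P := hVR.aemeasurable
  have hidV : Integrable (fun x : ℝ => x) (P.map V) :=
    (integrable_map_measure (by fun_prop) hVm).2 (hVL.integrable (by norm_num))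
  have lhs : ∫ ω, V ω * f (U ω) ∂P
      = ∫ r, ∫ x, x * f (r + (x / s) • c) ∂P.map V ∂P.map R := by
    have e : ∫ ω, V ω * f (U ω) ∂P = ∫ z, z.1 * f (z.2 + (z.1 / s) • c)
        ∂(P.map fun ω => (V ω, R ω)) := by
      rw [integral_map hpair (Measurable.aestronglyMeasurable (by fun_prop))]
      simp only [hUR]
    rw [e, hmap, integral_prod_symm]
    refine ((hidV.comp_fst (P.map R)).mul_bdd (c := C) ?_ (.of_forall fun z => hC _))
    exact Measurable.aestronglyMeasurable (by fun_prop)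
  have rhs : ∫ ω, f' (U ω) ∂P = ∫ r, ∫ x, f' (r + (x / s) • c) ∂P.map V ∂P.map R := by
    have e : ∫ ω, f' (U ω) ∂P = ∫ z, f' (z.2 + (z.1 / s) • c)
        ∂(P.map fun ω => (V ω, R ω)) := by
      rw [integral_map hpair (Measurable.aestronglyMeasurable (by fun_prop))]
      simp only [hUR]
    rw [e, hmap, integral_prod_symm]
    exact Integrable.of_bound (Measurable.aestronglyMeasurable (by fun_prop)) C'
      (.of_forall fun z => hC' _)
  rw [lhs, rhs]
  congr 1; ext r
  rw [hVmap]
  rw [integral_id_mul_gaussianReal _ (g' := fun x => f' (r + (x / s) • c) * s⁻¹) (C := C)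
    (C' := C' * |s⁻¹|) (fun x => ?_) (fun x => hC _) (fun x => ?_)]
  · rw [integral_mul_const]
    rw [Real.coe_toNNReal s (variance_nonneg V P)]
    field_simp
  · have := (hd r (x / s)).comp x ((hasDerivAt_id x).div_const s)
    simpa [Function.comp_def] using this
  · rw [abs_mul]
    exact mul_le_mul_of_nonneg_right (hC' _) (abs_nonneg _)

/-! ### Smooth maximum and its derivatives. -/

section Softmax

variable {ι : Type*} [Fintype ι]

/-- The logarithm of a sum of exponentials, a smooth version of the maximum. -/
noncomputable def logSumExp (x : ι → ℝ) : ℝ := Real.log (∑ i, Real.exp (x i))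

/-- The softmax weights, the gradient of `logSumExp`. -/
noncomputable def softmax (x : ι → ℝ) (i : ι) : ℝ := Real.exp (x i) / ∑ j, Real.exp (x j)

theorem softmax_nonneg (x : ι → ℝ) (i : ι) : 0 ≤ softmax x i :=
  div_nonneg (Real.exp_pos _).le (Finset.sum_nonneg fun _ _ => (Real.exp_pos _).le)

@[fun_prop]
theorem measurable_softmax (i : ι) : Measurable fun x : ι → ℝ => softmax x i := by
  unfold softmax; fun_prop

@[fun_prop]
theorem measurable_logSumExp : Measurable (logSumExp : (ι → ℝ) → ℝ) := by
  unfold logSumExp; fun_prop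

/-- The Hessian of `logSumExp` paired with an array, in terms of increments. -/
theorem sum_mul_sub_sum_eq {q : ι → ℝ} (hq : ∑ i, q i = 1) (D : ι → ι → ℝ) :
    ∑ i, q i * (D i i - ∑ j, q j * D i j)
      = (1 / 2) * ∑ i, ∑ j, q i * q j * (D i i + D j j - 2 * D i j) := by
  have h1 : ∑ i, ∑ j, q i * q j * D i i = ∑ i, q i * D i i := by
    refine Finset.sum_congr rfl fun i _ => ?_
    calc ∑ j, q i * q j * D i i = (∑ j, q j) * (q i * D i i) := by
          rw [Finset.sum_mul]; exact Finset.sum_congr rfl fun _ _ => by ring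
      _ = _ := by rw [hq, one_mul]
  have h2 : ∑ i, ∑ j, q i * q j * D j j = ∑ i, q i * D i i := by
    rw [Finset.sum_comm, ← h1]
    exact Finset.sum_congr rfl fun i _ => Finset.sum_congr rfl fun j _ => by ring
  have h3 : ∑ i, ∑ j, q i * q j * (D i i + D j j - 2 * D i j)
      = 2 * ∑ i, q i * D i i - 2 * ∑ i, ∑ j, q i * q j * D i j := by
    rw [two_mul (∑ i, q i * D i i)]
    nth_rw 1 [← h1]
    rw [← h2, Finset.mul_sum]
    simp only [Finset.mul_sum, ← Finset.sum_add_distrib, ← Finset.sum_sub_distrib]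
    exact Finset.sum_congr rfl fun i _ => Finset.sum_congr rfl fun j _ => by ring
  rw [h3]
  simp only [mul_sub, Finset.sum_sub_distrib, Finset.mul_sum]
  have : ∀ i j, q i * (q j * D i j) = q i * q j * D i j := fun i j => by ring
  simp only [this]
  ring_nf

variable [Nonempty ι]

theorem sum_exp_pos (x : ι → ℝ) : 0 < ∑ i, Real.exp (x i) :=
  Finset.sum_pos (fun _ _ => Real.exp_pos _) Finset.univ_nonempty

theorem sum_softmax (x : ι → ℝ) : ∑ i, softmax x i = 1 := by
  simp only [softmax, ← Finset.sum_div]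
  exact div_self (sum_exp_pos x).ne'

theorem softmax_le_one (x : ι → ℝ) (i : ι) : softmax x i ≤ 1 := by
  rw [← sum_softmax x]
  exact Finset.single_le_sum (fun j _ => softmax_nonneg x j) (Finset.mem_univ i)

theorem abs_softmax_le (x : ι → ℝ) (i : ι) : |softmax x i| ≤ 1 := by
  rw [abs_of_nonneg (softmax_nonneg x i)]; exact softmax_le_one x i

theorem HasDerivAt.logSumExp {x : ℝ → ι → ℝ} {x' : ι → ℝ} {t : ℝ}
    (h : ∀ i, HasDerivAt (fun t => x t i) (x' i) t) :
    HasDerivAt (fun t => logSumExp (x t)) (∑ i, softmax (x t) i * x' i) t := by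
  have := (HasDerivAt.fun_sum fun i _ => (h i).exp).log (sum_exp_pos _).ne'
  refine this.congr_deriv ?_
  rw [Finset.sum_div]
  exact Finset.sum_congr rfl fun i _ => by simp only [softmax]; ring

theorem HasDerivAt.softmax {x : ℝ → ι → ℝ} {x' : ι → ℝ} {t : ℝ}
    (h : ∀ i, HasDerivAt (fun t => x t i) (x' i) t) (i : ι) :
    HasDerivAt (fun t => softmax (x t) i)
      (softmax (x t) i * (x' i - ∑ j, softmax (x t) j * x' j)) t := by
  have h0 := (sum_exp_pos (x t)).ne'
  have := (h i).exp.div (HasDerivAt.fun_sum fun i _ => (h i).exp) h0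
  refine this.congr_deriv ?_
  have e : ∑ j, _root_.softmax (x t) j * x' j
      = (∑ j, Real.exp (x t j) * x' j) / ∑ j, Real.exp (x t j) := by
    rw [Finset.sum_div]
    exact Finset.sum_congr rfl fun i _ => by simp only [_root_.softmax]; ring
  rw [e, _root_.softmax]
  field_simp

theorem le_logSumExp (x : ι → ℝ) (i : ι) : x i ≤ logSumExp x := by
  rw [logSumExp, Real.le_log_iff_exp_le (sum_exp_pos x)]
  exact Finset.single_le_sum (f := fun i => Real.exp (x i))
    (fun j _ => (Real.exp_pos _).le) (Finset.mem_univ i)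

theorem sup'_le_logSumExp (x : ι → ℝ) :
    Finset.univ.sup' Finset.univ_nonempty x ≤ logSumExp x :=
  Finset.sup'_le _ _ fun i _ => le_logSumExp x i

theorem logSumExp_le (x : ι → ℝ) :
    logSumExp x ≤ Finset.univ.sup' Finset.univ_nonempty x + Real.log (Fintype.card ι) := by
  have hN : (0 : ℝ) < Fintype.card ι := by exact_mod_cast Fintype.card_pos
  rw [logSumExp, Real.log_le_iff_le_exp (sum_exp_pos x), Real.exp_add, Real.exp_log hN]
  calc ∑ i, Real.exp (x i)
      ≤ ∑ _i : ι, Real.exp (Finset.univ.sup' Finset.univ_nonempty x) :=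
        Finset.sum_le_sum fun i _ => Real.exp_le_exp.2 (Finset.le_sup' x (Finset.mem_univ i))
    _ = _ := by simp [mul_comm]

theorem abs_logSumExp_le (x : ι → ℝ) :
    |logSumExp x| ≤ ∑ i, |x i| + Real.log (Fintype.card ι) := by
  have hN : (1 : ℝ) ≤ Fintype.card ι := by exact_mod_cast Fintype.card_pos
  have hl := Real.log_nonneg hN
  have hx : ∀ i, |x i| ≤ ∑ i, |x i| := fun i =>
    Finset.single_le_sum (f := fun i => |x i|) (fun _ _ => abs_nonneg _) (Finset.mem_univ i)
  rw [abs_le]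
  constructor
  · have i := Classical.arbitrary ι
    linarith [le_logSumExp x i, hx i, neg_abs_le (x i)]
  · refine (logSumExp_le x).trans (add_le_add_left (Finset.sup'_le _ _ fun i _ => ?_) _)
    exact (le_abs_self _).trans (hx i)

end Softmax

/-! ### Sudakov–Fernique comparison by interpolation. -/

section SudakovFernique

variable {Ω ι : Type*} [MeasurableSpace Ω] [Fintype ι] [Nonempty ι] {P : Measure Ω}
  {X W : Ω → ι → ℝ}

/-- Gaussian interpolation: comparing increments compares expected `logSumExp`. -/
theorem integral_logSumExp_le_of_increments_le
    (h : HasGaussianLaw (fun ω => (X ω, W ω)) P)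
    (hX : ∀ i, ∫ ω, X ω i ∂P = 0) (hW : ∀ i, ∫ ω, W ω i ∂P = 0)
    (hXW : ∀ i j, ∫ ω, X ω i * W ω j ∂P = 0)
    (hinc : ∀ i j, ∫ ω, (X ω i - X ω j) ^ 2 ∂P ≤ ∫ ω, (W ω i - W ω j) ^ 2 ∂P) :
    ∫ ω, logSumExp (X ω) ∂P ≤ ∫ ω, logSumExp (W ω) ∂P := by
  have := h.isProbabilityMeasure
  have hX2 : ∀ i, MemLp (fun ω => X ω i) 2 P := fun i => (h.fst.eval i).memLp_two
  have hW2 : ∀ i, MemLp (fun ω => W ω i) 2 P := fun i => (h.snd.eval i).memLp_two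
  have hX1 : ∀ i, Integrable (fun ω => X ω i) P := fun i => (hX2 i).integrable (by norm_num)
  have hW1 : ∀ i, Integrable (fun ω => W ω i) P := fun i => (hW2 i).integrable (by norm_num)
  have hXm : AEMeasurable X P := h.fst.aemeasurable
  have hWm : AEMeasurable W P := h.snd.aemeasurable
  set D : ι → ι → ℝ := fun i j => ∫ ω, W ω i * W ω j ∂P - ∫ ω, X ω i * X ω j ∂P with hD
  have hDpos : ∀ i j, 0 ≤ D i i + D j j - 2 * D i j := by
    intro i j
    have sq : ∀ Z : Ω → ι → ℝ, (∀ i, MemLp (fun ω => Z ω i) 2 P) →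
        ∫ ω, (Z ω i - Z ω j) ^ 2 ∂P = ∫ ω, Z ω i * Z ω i ∂P + ∫ ω, Z ω j * Z ω j ∂P
          - 2 * ∫ ω, Z ω i * Z ω j ∂P := by
      intro Z hZ
      have hm : ∀ i j, Integrable (fun ω => Z ω i * Z ω j) P :=
        fun i j => (hZ i).integrable_mul (hZ j)
      rw [← integral_const_mul, ← integral_add (hm i i) (hm j j),
        ← integral_sub ((hm i i).fun_add (hm j j)) ((hm i j).const_mul 2)]
      congr 1; ext ω; ring
    have := hinc i j
    rw [sq X hX2, sq W hW2] at this
    simp only [hD]; linarith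
  -- U runs from X at θ = 0 to W at θ = π/2, and V is its derivative in θ. Since X and W are
  -- uncorrelated, E[Vᵢ Uⱼ] is sin θ cos θ times the difference of the covariances.
  set U : ℝ → Ω → ι → ℝ := fun θ ω => Real.cos θ • X ω + Real.sin θ • W ω with hU
  set V : ℝ → Ω → ι → ℝ := fun θ ω => Real.cos θ • W ω - Real.sin θ • X ω with hV
  have hUm : ∀ θ, AEMeasurable (U θ) P := fun θ => by simp only [hU]; fun_prop
  have hVm : ∀ θ, AEMeasurable (V θ) P := fun θ => by simp only [hV]; fun_prop
  have hcov : ∀ θ i j, ∫ ω, V θ ω i * U θ ω j ∂P = Real.sin θ * Real.cos θ * D i j := by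
    intro θ i j
    have e : ∀ ω, V θ ω i * U θ ω j = Real.sin θ * Real.cos θ * (W ω i * W ω j)
        - Real.sin θ * Real.cos θ * (X ω i * X ω j)
        + (Real.cos θ * Real.cos θ * (X ω j * W ω i)
          - Real.sin θ * Real.sin θ * (X ω i * W ω j)) := by
      intro ω; simp [hU, hV]; ring
    have i1 := ((hW2 i).integrable_mul (hW2 j)).const_mul (Real.sin θ * Real.cos θ)
    have i2 := ((hX2 i).integrable_mul (hX2 j)).const_mul (Real.sin θ * Real.cos θ)
    have i3 := ((hX2 j).integrable_mul (hW2 i)).const_mul (Real.cos θ * Real.cos θ)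
    have i4 := ((hX2 i).integrable_mul (hW2 j)).const_mul (Real.sin θ * Real.sin θ)
    simp only [Pi.mul_apply] at i1 i2 i3 i4
    simp only [e]
    rw [integral_add (i1.fun_sub i2) (i3.fun_sub i4), integral_sub i1 i2, integral_sub i3 i4]
    simp only [integral_const_mul, hXW, hD]
    ring
  set G : ℝ → Ω → ℝ := fun θ ω => ∑ i, softmax (U θ ω) i * V θ ω i with hG
  have hderiv : ∀ θ, HasDerivAt (fun θ => ∫ ω, logSumExp (U θ ω) ∂P) (∫ ω, G θ ω ∂P) θ := by
    intro θ
    have hb : Integrable (fun ω => ∑ i, (|W ω i| + |X ω i|)) P :=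
      integrable_finsetSum _ fun i _ => (hW1 i).abs.add (hX1 i).abs
    refine (hasDerivAt_integral_of_dominated_loc_of_deriv_le (s := Set.univ)
      (F := fun θ ω => logSumExp (U θ ω))
      (bound := fun ω => ∑ i, (|W ω i| + |X ω i|)) Filter.univ_mem
      (.of_forall fun θ => (measurable_logSumExp.comp_aemeasurable (hUm θ)).aestronglyMeasurable)
      ?_ ?_ (.of_forall fun ω θ _ => ?_) hb (.of_forall fun ω θ _ => ?_)).2
    · have hb' : Integrable (fun ω => ∑ i, |U θ ω i| + Real.log (Fintype.card ι)) P := by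
        refine (integrable_finsetSum _ fun i _ => Integrable.abs ?_).add (integrable_const _)
        simpa [hU] using ((hX1 i).const_mul (Real.cos θ)).fun_add ((hW1 i).const_mul (Real.sin θ))
      exact hb'.mono' (measurable_logSumExp.comp_aemeasurable (hUm θ)).aestronglyMeasurable
        (.of_forall fun ω => abs_logSumExp_le _)
    · refine AEMeasurable.aestronglyMeasurable ?_
      simp only [hG]
      refine Finset.aemeasurable_fun_sum _ fun i _ => ?_
      exact ((measurable_softmax i).comp_aemeasurable (hUm θ)).mul
        ((measurable_pi_apply i).comp_aemeasurable (hVm θ))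
    · refine (Finset.abs_sum_le_sum_abs _ _).trans (Finset.sum_le_sum fun i _ => ?_)
      rw [abs_mul]
      refine (mul_le_of_le_one_left (abs_nonneg _) (abs_softmax_le _ i)).trans ?_
      simp only [hV, Pi.sub_apply, Pi.smul_apply, smul_eq_mul]
      refine (abs_sub _ _).trans (add_le_add ?_ ?_) <;> rw [abs_mul]
      · exact mul_le_of_le_one_left (abs_nonneg _) (Real.abs_cos_le_one _)
      · exact mul_le_of_le_one_left (abs_nonneg _) (Real.abs_sin_le_one _)
    · refine HasDerivAt.logSumExp fun i => ?_
      have := ((Real.hasDerivAt_cos θ).mul_const (X ω i)).add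
        ((Real.hasDerivAt_sin θ).mul_const (W ω i))
      refine this.congr_deriv ?_
      simp [hV]; ring
  have hnonneg : ∀ θ ∈ Set.Icc 0 (Real.pi / 2), 0 ≤ ∫ ω, G θ ω ∂P := by
    intro θ hθ
    have hsc : 0 ≤ Real.sin θ * Real.cos θ :=
      mul_nonneg (Real.sin_nonneg_of_nonneg_of_le_pi hθ.1 (by linarith [hθ.2, Real.pi_pos]))
        (Real.cos_nonneg_of_mem_Icc ⟨by linarith [hθ.1, Real.pi_pos], hθ.2⟩)
    have hstein : ∀ i, ∫ ω, V θ ω i * softmax (U θ ω) i ∂P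
        = ∫ ω, softmax (U θ ω) i * (Real.sin θ * Real.cos θ * D i i
            - ∑ j, softmax (U θ ω) j * (Real.sin θ * Real.cos θ * D i j)) ∂P := by
      intro i
      set c : ι → ℝ := fun j => Real.sin θ * Real.cos θ * D i j with hc
      have hVU : HasGaussianLaw (fun ω => (V θ ω i, U θ ω)) P := by
        let fs := ContinuousLinearMap.fst ℝ (ι → ℝ) (ι → ℝ)
        let sn := ContinuousLinearMap.snd ℝ (ι → ℝ) (ι → ℝ)
        let L : (ι → ℝ) × (ι → ℝ) →L[ℝ] ℝ × (ι → ℝ) :=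
          ((ContinuousLinearMap.proj i).comp (Real.cos θ • sn - Real.sin θ • fs)).prod
            (Real.cos θ • fs + Real.sin θ • sn)
        exact h.map_fun L
      have hVi : ∫ ω, V θ ω i ∂P = 0 := by
        have := integral_sub ((hW1 i).const_mul (Real.cos θ)) ((hX1 i).const_mul (Real.sin θ))
        simpa [hV, integral_const_mul, hX, hW] using this
      refine hVU.integral_mul_comp (c := c) hVi (hcov θ i) (f := fun x => softmax x i)
        (f' := fun x => softmax x i * (c i - ∑ j, softmax x j * c j)) (measurable_softmax i)
        (by fun_prop) (fun x t => ?_) (C := 1) (fun x => abs_softmax_le x i)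
        (C' := |c i| + ∑ j, |c j|) (fun x => ?_)
      · refine HasDerivAt.softmax (x := fun t => x + t • c) (fun j => ?_) i
        simpa using ((hasDerivAt_id t).mul_const (c j)).const_add (x j)
      · rw [abs_mul]
        refine (mul_le_of_le_one_left (abs_nonneg _) (abs_softmax_le _ i)).trans ?_
        refine (abs_sub _ _).trans (add_le_add_right ?_ _)
        refine (Finset.abs_sum_le_sum_abs _ _).trans (Finset.sum_le_sum fun j _ => ?_)
        rw [abs_mul]
        exact mul_le_of_le_one_left (abs_nonneg _) (abs_softmax_le _ j)
    have hint : ∀ i, Integrable (fun ω => V θ ω i * softmax (U θ ω) i) P := by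
      intro i
      have hVi : Integrable (fun ω => V θ ω i) P := by
        simpa [hV] using ((hW1 i).const_mul (Real.cos θ)).fun_sub ((hX1 i).const_mul (Real.sin θ))
      exact hVi.mul_bdd (c := 1)
        ((measurable_softmax i).comp_aemeasurable (hUm θ)).aestronglyMeasurable
        (.of_forall fun ω => abs_softmax_le _ i)
    have hint' : ∀ i, Integrable (fun ω => softmax (U θ ω) i * (Real.sin θ * Real.cos θ * D i i
            - ∑ j, softmax (U θ ω) j * (Real.sin θ * Real.cos θ * D i j))) P := by
      intro i
      have hm : ∀ j, AEMeasurable (fun ω => softmax (U θ ω) j) P :=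
        fun j => (measurable_softmax j).comp_aemeasurable (hUm θ)
      refine Integrable.of_bound (C := |Real.sin θ * Real.cos θ * D i i|
        + ∑ j, |Real.sin θ * Real.cos θ * D i j|) ?_ (.of_forall fun ω => ?_)
      · refine AEMeasurable.aestronglyMeasurable ((hm i).mul (aemeasurable_const.sub ?_))
        exact Finset.aemeasurable_fun_sum _ fun j _ => (hm j).mul_const _
      · rw [Real.norm_eq_abs, abs_mul]
        refine (mul_le_of_le_one_left (abs_nonneg _) (abs_softmax_le _ i)).trans ?_
        refine (abs_sub _ _).trans (add_le_add_right ?_ _)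
        refine (Finset.abs_sum_le_sum_abs _ _).trans (Finset.sum_le_sum fun j _ => ?_)
        rw [abs_mul]
        exact mul_le_of_le_one_left (abs_nonneg _) (abs_softmax_le _ j)
    have hGe : ∫ ω, G θ ω ∂P = ∑ i, ∫ ω, V θ ω i * softmax (U θ ω) i ∂P := by
      rw [← integral_finsetSum _ fun i _ => hint i]
      simp only [hG, mul_comm]
    rw [hGe, Finset.sum_congr rfl fun i _ => hstein i, ← integral_finsetSum _ fun i _ => hint' i]
    refine integral_nonneg fun ω => ?_
    -- After integration by parts the integrand is the Hessian of `logSumExp` paired with the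
    -- covariance difference. The softmax weights sum to one, so only increments appear, with
    -- nonnegative coefficients.
    have := sum_mul_sub_sum_eq (q := softmax (U θ ω)) (sum_softmax _)
      (fun i j => Real.sin θ * Real.cos θ * D i j)
    simp only [this, Pi.zero_apply]
    refine mul_nonneg (by norm_num) (Finset.sum_nonneg fun i _ => Finset.sum_nonneg fun j _ => ?_)
    refine mul_nonneg (mul_nonneg (softmax_nonneg _ _) (softmax_nonneg _ _)) ?_
    have := mul_nonneg hsc (hDpos i j)
    linarith
  have hpi : (0 : ℝ) ≤ Real.pi / 2 := by positivity
  have hmono : MonotoneOn (fun θ => ∫ ω, logSumExp (U θ ω) ∂P) (Set.Icc 0 (Real.pi / 2)) :=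
    monotoneOn_of_deriv_nonneg (convex_Icc _ _)
      (fun θ _ => (hderiv θ).continuousAt.continuousWithinAt)
      (fun θ _ => (hderiv θ).differentiableAt.differentiableWithinAt)
      (fun θ hθ => by rw [(hderiv θ).deriv]; exact hnonneg θ (interior_subset hθ))
  have := hmono (Set.left_mem_Icc.2 hpi) (Set.right_mem_Icc.2 hpi) hpi
  simpa [hU] using this

theorem measurable_univ_sup' :
    Measurable fun x : ι → ℝ => Finset.univ.sup' Finset.univ_nonempty x := by
  have := Finset.measurable_sup' (s := (Finset.univ : Finset ι)) Finset.univ_nonempty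
    (f := fun i (x : ι → ℝ) => x i) (fun i _ => measurable_pi_apply i)
  convert this using 1
  ext x; simp

theorem integrable_univ_sup' {Z : Ω → ι → ℝ} (hZ : ∀ i, Integrable (fun ω => Z ω i) P) :
    Integrable (fun ω => Finset.univ.sup' Finset.univ_nonempty (Z ω)) P := by
  have hZm : AEMeasurable Z P := aemeasurable_pi_lambda _ fun i => (hZ i).aemeasurable
  refine (integrable_finsetSum Finset.univ fun i _ => (hZ i).abs).mono'
    (measurable_univ_sup'.comp_aemeasurable hZm).aestronglyMeasurable (.of_forall fun ω => ?_)
  have hx : ∀ i, |Z ω i| ≤ ∑ i, |Z ω i| := fun i =>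
    Finset.single_le_sum (f := fun i => |Z ω i|) (fun _ _ => abs_nonneg _) (Finset.mem_univ i)
  rw [Real.norm_eq_abs, abs_le]
  constructor
  · have i := Classical.arbitrary ι
    have := Finset.le_sup' (Z ω) (Finset.mem_univ i)
    linarith [hx i, neg_abs_le (Z ω i)]
  · exact Finset.sup'_le _ _ fun i _ => (le_abs_self _).trans (hx i)

/-- **The Sudakov–Fernique inequality** for finite centred Gaussian families. -/
theorem sudakov_fernique
    (h : HasGaussianLaw (fun ω => (X ω, W ω)) P)
    (hX : ∀ i, ∫ ω, X ω i ∂P = 0) (hW : ∀ i, ∫ ω, W ω i ∂P = 0)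
    (hXW : ∀ i j, ∫ ω, X ω i * W ω j ∂P = 0)
    (hinc : ∀ i j, ∫ ω, (X ω i - X ω j) ^ 2 ∂P ≤ ∫ ω, (W ω i - W ω j) ^ 2 ∂P) :
    ∫ ω, Finset.univ.sup' Finset.univ_nonempty (X ω) ∂P
      ≤ ∫ ω, Finset.univ.sup' Finset.univ_nonempty (W ω) ∂P := by
  have := h.isProbabilityMeasure
  have hX1 : ∀ i, Integrable (fun ω => X ω i) P := fun i => (h.fst.eval i).integrable
  have hW1 : ∀ i, Integrable (fun ω => W ω i) P := fun i => (h.snd.eval i).integrable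
  have supint : ∀ Z : Ω → ι → ℝ, (∀ i, Integrable (fun ω => Z ω i) P) →
      Integrable (fun ω => Finset.univ.sup' Finset.univ_nonempty (Z ω)) P :=
    fun Z hZ => integrable_univ_sup' hZ
  have lseint : ∀ Z : Ω → ι → ℝ, AEMeasurable Z P → (∀ i, Integrable (fun ω => Z ω i) P) →
      Integrable (fun ω => logSumExp (Z ω)) P := by
    intro Z hZm hZ
    exact ((integrable_finsetSum Finset.univ fun i _ => (hZ i).abs).add (integrable_const _)).mono'
      (measurable_logSumExp.comp_aemeasurable hZm).aestronglyMeasurable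
      (.of_forall fun ω => abs_logSumExp_le _)
  have hsup : ∀ (b : ℝ) (x : ι → ℝ), 0 < b → Finset.univ.sup' Finset.univ_nonempty (b • x)
      = b * Finset.univ.sup' Finset.univ_nonempty x := by
    intro b x hb
    rw [Finset.mul₀_sup' hb.le]; rfl
  set a := ∫ ω, Finset.univ.sup' Finset.univ_nonempty (X ω) ∂P
  set d := ∫ ω, Finset.univ.sup' Finset.univ_nonempty (W ω) ∂P
  -- `logSumExp` exceeds the maximum by at most the logarithm of the number of indices. Scaling both
  -- families by b makes this error negligible as b grows.
  have key : ∀ b : ℝ, 0 < b → b * a ≤ b * d + Real.log (Fintype.card ι) := by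
    intro b hb
    have hg : HasGaussianLaw (fun ω => (b • X ω, b • W ω)) P := h.fun_smul b
    have h1 := integral_logSumExp_le_of_increments_le hg
      (fun i => by simp [integral_const_mul, hX]) (fun i => by simp [integral_const_mul, hW])
      (fun i j => by
        have : ∀ ω, (b • X ω) i * (b • W ω) j = b ^ 2 * (X ω i * W ω j) := fun ω => by
          simp; ring
        simp only [this, integral_const_mul, hXW, mul_zero])
      (fun i j => by
        have : ∀ Z : Ω → ι → ℝ, ∫ ω, ((b • Z ω) i - (b • Z ω) j) ^ 2 ∂P
            = b ^ 2 * ∫ ω, (Z ω i - Z ω j) ^ 2 ∂P := fun Z => by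
          rw [← integral_const_mul]; congr 1; ext ω; simp; ring
        rw [this X, this W]
        exact mul_le_mul_of_nonneg_left (hinc i j) (sq_nonneg b))
    have hXb : ∀ i, Integrable (fun ω => (b • X ω) i) P := fun i => (hX1 i).const_mul b
    have hWb : ∀ i, Integrable (fun ω => (b • W ω) i) P := fun i => (hW1 i).const_mul b
    have h2 := integral_mono (supint _ hXb)
      (lseint _ hg.fst.aemeasurable hXb) (fun ω => sup'_le_logSumExp (b • X ω))
    have h3 := integral_mono (lseint _ hg.snd.aemeasurable hWb)
      ((supint _ hWb).fun_add (integrable_const (Real.log (Fintype.card ι))))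
      (fun ω => logSumExp_le (b • W ω))
    rw [integral_add (supint _ hWb) (integrable_const _)] at h3
    simp only [hsup b _ hb, integral_const_mul] at h2 h3
    simp only [integral_const, probReal_univ, one_smul] at h3
    linarith
  by_contra! hlt
  have hl : 0 ≤ Real.log (Fintype.card ι) :=
    Real.log_nonneg (by exact_mod_cast Fintype.card_pos)
  -- This b makes b(a − d) exceed the allowed error by exactly one.
  have := key ((Real.log (Fintype.card ι) + 1) / (a - d)) (div_pos (by linarith) (by linarith))
  have e : (Real.log (Fintype.card ι) + 1) / (a - d) * (a - d) = Real.log (Fintype.card ι) + 1 :=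
    div_mul_cancel₀ _ (by linarith)
  nlinarith

end SudakovFernique

/-! ### Second-moment bounds and standard Gaussian vectors. -/

theorem sq_integral_le_integral_sq {Ω : Type*} [MeasurableSpace Ω] {P : Measure Ω}
    [IsProbabilityMeasure P] {f : Ω → ℝ} (hf : MemLp f 2 P) :
    (∫ ω, f ω ∂P) ^ 2 ≤ ∫ ω, f ω ^ 2 ∂P := by
  have := variance_nonneg f P
  rw [variance_eq_sub hf] at this
  simpa using this

theorem integral_sqrt_le_sqrt_integral {Ω : Type*} [MeasurableSpace Ω] {P : Measure Ω}
    [IsProbabilityMeasure P] {f : Ω → ℝ} (hf : Integrable f P) (h0 : ∀ ω, 0 ≤ f ω) :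
    ∫ ω, √(f ω) ∂P ≤ √(∫ ω, f ω ∂P) := by
  refine Real.le_sqrt_of_sq_le ?_
  have h2 : MemLp (fun ω => √(f ω)) 2 P := by
    rw [memLp_two_iff_integrable_sq (Real.continuous_sqrt.comp_aestronglyMeasurable hf.1)]
    simpa only [Real.sq_sqrt (h0 _)] using hf
  simpa only [Real.sq_sqrt (h0 _)] using sq_integral_le_integral_sq h2

section StdGaussian

variable {F : Type*} [NormedAddCommGroup F] [InnerProductSpace ℝ F] [FiniteDimensional ℝ F]
  [MeasurableSpace F] [BorelSpace F]

theorem memLp_inner_stdGaussian (x : F) : MemLp (fun h => inner ℝ h x) 2 (stdGaussian F) := by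
  have := IsGaussian.memLp_dual (stdGaussian F) (innerSL ℝ x) 2 (by norm_num)
  simpa [real_inner_comm] using this

theorem integral_inner_stdGaussian (x : F) : ∫ h, inner ℝ h x ∂stdGaussian F = 0 := by
  have := integral_strongDual_stdGaussian (innerSL ℝ x)
  simpa [real_inner_comm] using this

theorem integral_inner_sq_stdGaussian (x : F) :
    ∫ h, inner ℝ h x ^ 2 ∂stdGaussian F = ‖x‖ ^ 2 := by
  have := variance_dual_stdGaussian (innerSL ℝ x)
  rw [variance_of_integral_eq_zero (by fun_prop) (integral_strongDual_stdGaussian _)] at this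
  simpa [real_inner_comm] using this

end StdGaussian

/-- The right side minus the left is (‖a‖‖b‖ − ‖a'‖‖b'‖)² + 2(‖a‖‖a'‖ − ⟨a, a'⟩)(‖b‖‖b'‖ − ⟨b, b'⟩),
nonnegative by Cauchy–Schwarz. This is the increment condition in the Chevet comparison. -/
theorem sum_norm_smul_sub_smul_sq_le {κ F : Type*} [Fintype κ] [NormedAddCommGroup F]
    [InnerProductSpace ℝ F] (a a' : EuclideanSpace ℝ κ) (b b' : F) :
    ∑ k, ‖a k • b - a' k • b'‖ ^ 2
      ≤ ‖‖a‖ • b - ‖a'‖ • b'‖ ^ 2 + ‖‖b‖ • a - ‖b'‖ • a'‖ ^ 2 := by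
  have h1 : ∑ k, ‖a k • b - a' k • b'‖ ^ 2
      = ‖a‖ ^ 2 * ‖b‖ ^ 2 + ‖a'‖ ^ 2 * ‖b'‖ ^ 2 - 2 * inner ℝ a a' * inner ℝ b b' := by
    rw [EuclideanSpace.real_norm_sq_eq, EuclideanSpace.real_norm_sq_eq, PiLp.inner_apply,
      Finset.sum_mul, Finset.sum_mul, Finset.mul_sum, Finset.sum_mul, ← Finset.sum_add_distrib,
      ← Finset.sum_sub_distrib]
    refine Finset.sum_congr rfl fun k _ => ?_
    rw [norm_sub_sq_real, norm_smul, norm_smul, inner_smul_left, inner_smul_right, mul_pow,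
      mul_pow]
    simp
    ring
  rw [h1, norm_sub_sq_real, norm_sub_sq_real, norm_smul, norm_smul, norm_smul, norm_smul,
    inner_smul_left, inner_smul_right, inner_smul_left, inner_smul_right]
  simp only [norm_norm, conj_trivial]
  have ha : inner ℝ a a' ≤ ‖a‖ * ‖a'‖ := real_inner_le_norm a a'
  have hb : inner ℝ b b' ≤ ‖b‖ * ‖b'‖ := real_inner_le_norm b b'
  nlinarith [mul_nonneg (sub_nonneg.2 ha) (sub_nonneg.2 hb),
    sq_nonneg (‖a‖ * ‖b‖ - ‖a'‖ * ‖b'‖)]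

/-! ### Chevet-type comparison. -/

section Chevet

variable {κ ι G F : Type*} [Fintype κ] [Fintype ι] [Nonempty ι]
  [NormedAddCommGroup G] [NormedSpace ℝ G] [SecondCountableTopology G]
  [MeasurableSpace G] [BorelSpace G]
  [NormedAddCommGroup F] [InnerProductSpace ℝ F] [FiniteDimensional ℝ F]
  [MeasurableSpace F] [BorelSpace F]

/-- A Gordon–Chevet comparison: a centred Gaussian family whose increments are dominated by those
of the tensors `aᵢ ⊗ bᵢ` is dominated, in expected maximum, by
`‖aᵢ‖⟨h, bᵢ⟩ + ‖bᵢ‖⟨g, aᵢ⟩` with independent standard Gaussian `h`, `g`. -/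
theorem integral_sup'_le_of_increments_le_tensor {ν : Measure G} [IsGaussian ν]
    (hν : ∀ l : StrongDual ℝ G, ∫ z, l z ∂ν = 0) (l : ι → StrongDual ℝ G)
    (a : ι → EuclideanSpace ℝ κ) (b : ι → F)
    (h : ∀ i j, ∫ z, (l i z - l j z) ^ 2 ∂ν ≤ ∑ k, ‖a i k • b i - a j k • b j‖ ^ 2) :
    ∫ z, Finset.univ.sup' Finset.univ_nonempty (fun i => l i z) ∂ν
      ≤ ∫ x, Finset.univ.sup' Finset.univ_nonempty
          (fun i => ‖a i‖ * inner ℝ x.1 (b i) + ‖b i‖ * inner ℝ x.2 (a i))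
          ∂((stdGaussian F).prod (stdGaussian (EuclideanSpace ℝ κ))) := by
  set γ := (stdGaussian F).prod (stdGaussian (EuclideanSpace ℝ κ)) with hγ
  let w : ι → StrongDual ℝ (F × EuclideanSpace ℝ κ) := fun i =>
    ‖a i‖ • (innerSL ℝ (b i)).comp (ContinuousLinearMap.fst ℝ _ _)
      + ‖b i‖ • (innerSL ℝ (a i)).comp (ContinuousLinearMap.snd ℝ _ _)
  have hw : ∀ i x, w i x = ‖a i‖ * inner ℝ x.1 (b i) + ‖b i‖ * inner ℝ x.2 (a i) := by
    intro i x; simp [w, real_inner_comm]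
  let M : G × (F × EuclideanSpace ℝ κ) →L[ℝ] (ι → ℝ) × (ι → ℝ) :=
    (ContinuousLinearMap.pi fun i => (l i).comp (ContinuousLinearMap.fst ℝ _ _)).prod
      (ContinuousLinearMap.pi fun i => (w i).comp (ContinuousLinearMap.snd ℝ _ _))
  have hg : HasGaussianLaw (fun ω : G × (F × EuclideanSpace ℝ κ) =>
      ((fun i => l i ω.1 : ι → ℝ), (fun i => w i ω.2 : ι → ℝ))) (ν.prod γ) :=
    (IsGaussian.hasGaussianLaw_id (μ := ν.prod γ)).map_fun M
  have h1 : ∀ x : F, Integrable (fun h => inner ℝ h x) (stdGaussian F) :=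
    fun x => (memLp_inner_stdGaussian x).integrable (by norm_num)
  have h2 : ∀ x : EuclideanSpace ℝ κ, Integrable (fun h => inner ℝ h x) (stdGaussian _) :=
    fun x => (memLp_inner_stdGaussian x).integrable (by norm_num)
  have hw0 : ∀ i, ∫ x, w i x ∂γ = 0 := by
    intro i
    simp only [hw]
    rw [integral_add (((h1 (b i)).comp_fst _).const_mul _) (((h2 (a i)).comp_snd _).const_mul _),
      integral_const_mul, integral_const_mul, integral_fun_fst (fun h => inner ℝ h (b i)),
      integral_fun_snd (fun h => inner ℝ h (a i)), integral_inner_stdGaussian,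
      integral_inner_stdGaussian]
    simp
  have hwsq : ∀ i j, ∫ x, (w i x - w j x) ^ 2 ∂γ
      = ‖‖a i‖ • b i - ‖a j‖ • b j‖ ^ 2 + ‖‖b i‖ • a i - ‖b j‖ • a j‖ ^ 2 := by
    intro i j
    set d := ‖a i‖ • b i - ‖a j‖ • b j
    set c := ‖b i‖ • a i - ‖b j‖ • a j
    have e : ∀ x : F × EuclideanSpace ℝ κ, (w i x - w j x) ^ 2
        = inner ℝ x.1 d ^ 2 + inner ℝ x.2 c ^ 2 + 2 * (inner ℝ x.1 d * inner ℝ x.2 c) := by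
      intro x
      rw [hw, hw]
      simp only [d, c, inner_sub_right, inner_smul_right]
      ring
    have i1 := (memLp_inner_stdGaussian d).integrable_sq.comp_fst (stdGaussian (EuclideanSpace ℝ κ))
    have i2 := (memLp_inner_stdGaussian c).integrable_sq.comp_snd (stdGaussian F)
    have i3 := (h1 d).mul_prod (h2 c)
    simp only [e]
    rw [integral_add (i1.fun_add i2) (i3.const_mul 2), integral_add i1 i2, integral_const_mul,
      integral_prod_mul (fun h => inner ℝ h d) (fun h => inner ℝ h c),
      integral_fun_fst (fun h => inner ℝ h d ^ 2), integral_fun_snd (fun h => inner ℝ h c ^ 2),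
      integral_inner_sq_stdGaussian, integral_inner_sq_stdGaussian, integral_inner_stdGaussian]
    simp
  have key := sudakov_fernique hg
    (fun i => by
      have := integral_fun_fst (μ := ν) (ν := γ) (l i)
      simpa [hν] using this)
    (fun i => by
      have := integral_fun_snd (μ := ν) (ν := γ) (w i)
      simpa [hw0] using this)
    (fun i j => by
      have := integral_prod_mul (μ := ν) (ν := γ) (l i) (w j)
      simpa [hν] using this)
    (fun i j => by
      have e1 := integral_fun_fst (μ := ν) (ν := γ) (fun z => (l i z - l j z) ^ 2)
      have e2 := integral_fun_snd (μ := ν) (ν := γ) (fun z => (w i z - w j z) ^ 2)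
      simp only [probReal_univ, one_smul] at e1 e2
      rw [e1, e2, hwsq]
      exact (h i j).trans (sum_norm_smul_sub_smul_sq_le _ _ _ _))
  have e1 := integral_fun_fst (μ := ν) (ν := γ)
    (fun z => Finset.univ.sup' Finset.univ_nonempty (fun i => l i z))
  have e2 := integral_fun_snd (μ := ν) (ν := γ)
    (fun z => Finset.univ.sup' Finset.univ_nonempty (fun i => w i z))
  simp only [probReal_univ, one_smul] at e1 e2
  rw [e1, e2] at key
  simpa only [hw] using key

end Chevet

/-! ### Sums of rank-one operators. -/

section CrossOp

variable {κ E : Type*} [Fintype κ] [NormedAddCommGroup E] [InnerProductSpace ℝ E]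

/-- The operator `v ↦ ∑ i, ⟨yᵢ, v⟩ zᵢ`. -/
noncomputable def crossOp (y z : κ → E) : E →L[ℝ] E :=
  ∑ i, (innerSL ℝ (y i)).smulRight (z i)

theorem crossOp_apply (y z : κ → E) (v : E) : crossOp y z v = ∑ i, inner ℝ (y i) v • z i := by
  simp [crossOp]

theorem inner_crossOp (y z : κ → E) (u v : E) :
    inner ℝ u (crossOp y z v) = ∑ i, inner ℝ (y i) v * inner ℝ u (z i) := by
  simp [crossOp_apply, inner_sum, inner_smul_right]

theorem norm_crossOp_le (y z : κ → E) : ‖crossOp y z‖ ≤ ∑ i, ‖y i‖ * ‖z i‖ := by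
  refine (norm_sum_le _ _).trans (Finset.sum_le_sum fun i _ => ?_)
  simp [ContinuousLinearMap.norm_smulRight_apply]

/-- The vector of coefficients `⟨yᵢ, v⟩`. -/
noncomputable def coeffs (y : κ → E) (v : E) : EuclideanSpace ℝ κ :=
  WithLp.toLp 2 fun i => inner ℝ (y i) v

theorem norm_coeffs_sq (y : κ → E) (v : E) : ‖coeffs y v‖ ^ 2 = inner ℝ v (crossOp y y v) := by
  rw [EuclideanSpace.real_norm_sq_eq, inner_crossOp]
  refine Finset.sum_congr rfl fun i _ => ?_
  rw [real_inner_comm (y i) v]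
  simp [coeffs, sq]

theorem norm_coeffs_le (y : κ → E) {v : E} (hv : ‖v‖ = 1) :
    ‖coeffs y v‖ ≤ √‖crossOp y y‖ := by
  refine Real.le_sqrt_of_sq_le ?_
  rw [norm_coeffs_sq]
  refine (real_inner_le_norm _ _).trans ?_
  simpa [hv] using (crossOp y y).le_opNorm v

theorem inner_coeffs (y : κ → E) (g : EuclideanSpace ℝ κ) (v : E) :
    inner ℝ g (coeffs y v) = inner ℝ (∑ i, g i • y i) v := by
  rw [PiLp.inner_apply, sum_inner]
  refine Finset.sum_congr rfl fun i _ => ?_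
  simp [coeffs, inner_smul_left, mul_comm]

end CrossOp

/-! ### The bilinear form conditionally on one of its arguments. -/

section Chaos

variable {κ E F : Type*} [Fintype κ]
  [NormedAddCommGroup E] [InnerProductSpace ℝ E] [FiniteDimensional ℝ E]
  [NormedAddCommGroup F] [InnerProductSpace ℝ F] [FiniteDimensional ℝ F]

theorem integral_norm_sum_smul_sq_stdGaussian (y : κ → E) :
    Integrable (fun g => ‖∑ i, g i • y i‖ ^ 2) (stdGaussian (EuclideanSpace ℝ κ)) ∧
    ∫ g, ‖∑ i, g i • y i‖ ^ 2 ∂stdGaussian (EuclideanSpace ℝ κ) = ∑ i, ‖y i‖ ^ 2 := by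
  have e := stdOrthonormalBasis ℝ E
  have h1 : ∀ g : EuclideanSpace ℝ κ, ‖∑ i, g i • y i‖ ^ 2
      = ∑ j, inner ℝ g (coeffs y (e j)) ^ 2 := by
    intro g
    rw [← e.sum_sq_inner_left]
    simp only [inner_coeffs]
  have hi : ∀ j ∈ Finset.univ, Integrable (fun g => inner ℝ g (coeffs y (e j)) ^ 2)
      (stdGaussian (EuclideanSpace ℝ κ)) :=
    fun j _ => (memLp_inner_stdGaussian _).integrable_sq
  simp only [h1]
  refine ⟨integrable_finsetSum _ hi, ?_⟩
  rw [integral_finsetSum _ hi]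
  simp only [integral_inner_sq_stdGaussian, EuclideanSpace.real_norm_sq_eq]
  rw [Finset.sum_comm]
  refine Finset.sum_congr rfl fun i _ => ?_
  rw [← e.sum_sq_inner_left]
  simp [coeffs]

/-- The comparison process is bounded pointwise by the norm of a combination of two vectors. -/
theorem comparison_le_sqrt (y : κ → E) {L : E →L[ℝ] F} {b : ℝ}
    (hL : ∀ u, ‖L u‖ ≤ b * ‖u‖) {v : E} (hv : ‖v‖ = 1) {s : ℝ} (hs : s ^ 2 = 1)
    (h : F) (g : EuclideanSpace ℝ κ) :
    ‖coeffs y v‖ * inner ℝ h (L (s • v)) + ‖L (s • v)‖ * inner ℝ g (coeffs y v)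
      ≤ √(‖crossOp y y‖ * ‖L.adjoint h‖ ^ 2 + b ^ 2 * ‖∑ i, g i • y i‖ ^ 2
          + 2 * (√‖crossOp y y‖ * b) * |inner ℝ h (L (∑ i, g i • y i))|) := by
  set k := ∑ i, g i • y i with hk
  set α := ‖coeffs y v‖
  set β := ‖L (s • v)‖
  have hα0 : 0 ≤ α := norm_nonneg _
  have hβ0 : 0 ≤ β := norm_nonneg _
  have hα : α ≤ √‖crossOp y y‖ := norm_coeffs_le y hv
  have hsn : ‖s‖ = 1 := by
    rw [Real.norm_eq_abs, ← abs_one, ← sq_eq_sq_iff_abs_eq_abs, hs, one_pow]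
  have hβ : β ≤ b := (hL (s • v)).trans_eq (by rw [norm_smul, hsn, hv, one_mul, mul_one])
  -- Both terms are pairings with the unit vector v, so their sum is at most the norm of a single
  -- vector, in which v enters only through α and β.
  have e1 : α * inner ℝ h (L (s • v)) + β * inner ℝ g (coeffs y v)
      = inner ℝ ((α * s) • L.adjoint h + β • k) v := by
    rw [inner_coeffs, inner_add_left, inner_smul_left, inner_smul_left,
      ContinuousLinearMap.adjoint_inner_left, map_smul, inner_smul_right]
    simp; ring
  have hα2 : α ^ 2 ≤ ‖crossOp y y‖ := by
    rw [← Real.sq_sqrt (norm_nonneg (crossOp y y))]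
    exact pow_le_pow_left₀ hα0 hα 2
  have hβ2 : β ^ 2 ≤ b ^ 2 := pow_le_pow_left₀ hβ0 hβ 2
  rw [e1]
  refine (real_inner_le_norm _ _).trans ?_
  rw [hv, mul_one]
  refine Real.le_sqrt_of_sq_le ?_
  rw [norm_add_sq_real, norm_smul, norm_smul, inner_smul_left, inner_smul_right,
    ContinuousLinearMap.adjoint_inner_left, mul_pow, mul_pow]
  simp only [Real.norm_eq_abs, sq_abs, mul_pow, hs, mul_one, conj_trivial]
  have h3 : α * s * (β * inner ℝ h (L k)) ≤ √‖crossOp y y‖ * b * |inner ℝ h (L k)| := by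
    refine (le_abs_self _).trans ?_
    rw [abs_mul, abs_mul, abs_mul, abs_of_nonneg hα0, abs_of_nonneg hβ0, ← Real.norm_eq_abs s, hsn,
      mul_one, ← mul_assoc]
    exact mul_le_mul_of_nonneg_right (mul_le_mul hα hβ hβ0 (Real.sqrt_nonneg _)) (abs_nonneg _)
  have h1 := mul_le_mul_of_nonneg_right hα2 (sq_nonneg ‖L.adjoint h‖)
  have h2 := mul_le_mul_of_nonneg_right hβ2 (sq_nonneg ‖k‖)
  linarith

variable [MeasurableSpace F] [BorelSpace F]

/-- Expanding `L.adjoint h` in the basis reduces this to the variances of ⟨h, L eⱼ⟩. It is how the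
squared Hilbert–Schmidt norm of L, later bounded by nuclear norms, enters. -/
theorem integral_norm_adjoint_sq_stdGaussian {J : Type*} [Fintype J] (e : OrthonormalBasis J ℝ E)
    (L : E →L[ℝ] F) :
    Integrable (fun h => ‖L.adjoint h‖ ^ 2) (stdGaussian F) ∧
    ∫ h, ‖L.adjoint h‖ ^ 2 ∂stdGaussian F = ∑ j, ‖L (e j)‖ ^ 2 := by
  have h1 : ∀ h : F, ‖L.adjoint h‖ ^ 2 = ∑ j, inner ℝ h (L (e j)) ^ 2 := by
    intro h
    rw [← e.sum_sq_inner_left]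
    simp only [ContinuousLinearMap.adjoint_inner_left]
  have hi : ∀ j ∈ Finset.univ, Integrable (fun h => inner ℝ h (L (e j)) ^ 2) (stdGaussian F) :=
    fun j _ => (memLp_inner_stdGaussian _).integrable_sq
  simp only [h1]
  refine ⟨integrable_finsetSum _ hi, ?_⟩
  rw [integral_finsetSum _ hi]
  simp only [integral_inner_sq_stdGaussian]

variable [MeasurableSpace E] [BorelSpace E]

/-- The expected maximum over unit vectors of the quadratic forms of `crossOp y z`, for fixed `y`
and Gaussian `z` whose covariance is dominated by that of `L` on each coordinate. -/
theorem integral_sup'_abs_inner_crossOp_le {ι J : Type*} [Fintype ι] [Nonempty ι] [Fintype J]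
    {ν : Measure (κ → E)} [IsGaussian ν] (hν : ∀ l : StrongDual ℝ (κ → E), ∫ z, l z ∂ν = 0)
    (e : OrthonormalBasis J ℝ E) {L : E →L[ℝ] F} {A b : ℝ} (hb : 0 ≤ b)
    (hL : ∀ u, ‖L u‖ ≤ b * ‖u‖) (hA : ∑ j, ‖L (e j)‖ ^ 2 ≤ A)
    (hK : ∀ w : κ → E, ∫ z, (∑ i, inner ℝ (w i) (z i)) ^ 2 ∂ν ≤ ∑ i, ‖L (w i)‖ ^ 2)
    (y : κ → E) {v : ι → E} (hv : ∀ i, ‖v i‖ = 1) :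
    ∫ z, Finset.univ.sup' Finset.univ_nonempty
        (fun i => |inner ℝ (v i) (crossOp y z (v i))|) ∂ν
      ≤ √(‖crossOp y y‖ * A + b ^ 2 * ∑ i, ‖y i‖ ^ 2
          + 2 * (√‖crossOp y y‖ * b) * (b * √(∑ i, ‖y i‖ ^ 2))) := by
  set γ := (stdGaussian F).prod (stdGaussian (EuclideanSpace ℝ κ)) with hγ
  -- Doubling the index set by a sign turns the maximum of absolute values into the maximum of a
  -- linear Gaussian family.
  let sg : Bool → ℝ := fun c => if c then 1 else -1
  have hsg : ∀ c, sg c ^ 2 = 1 := by intro c; cases c <;> simp [sg]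
  let l : ι × Bool → StrongDual ℝ (κ → E) := fun i =>
    ∑ j, (sg i.2 * inner ℝ (y j) (v i.1)) •
      (innerSL ℝ (v i.1)).comp (ContinuousLinearMap.proj (R := ℝ) (φ := fun _ : κ => E) j)
  have hl : ∀ i z, l i z = sg i.2 * inner ℝ (v i.1) (crossOp y z (v i.1)) := by
    intro i z
    simp [l, inner_crossOp, Finset.mul_sum, mul_assoc]
  have hl' : ∀ i z, l i z = ∑ j, inner ℝ (coeffs y (v i.1) j • (sg i.2 • v i.1)) (z j) := by
    intro i z
    rw [hl, inner_crossOp, Finset.mul_sum]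
    refine Finset.sum_congr rfl fun j _ => ?_
    simp [coeffs, inner_smul_left]; ring
  have hcomp := integral_sup'_le_of_increments_le_tensor hν l (fun i => coeffs y (v i.1))
    (fun i => L (sg i.2 • v i.1)) (fun i j => by
      refine le_trans (le_of_eq ?_) ((hK fun k => coeffs y (v i.1) k • (sg i.2 • v i.1)
        - coeffs y (v j.1) k • (sg j.2 • v j.1)).trans (le_of_eq ?_))
      · congr 1; ext z
        rw [hl', hl', ← Finset.sum_sub_distrib]
        simp only [inner_sub_left]
      · simp only [map_sub, map_smul])
  have hlint : ∀ i, Integrable (fun z => l i z) ν := fun i => IsGaussian.integrable_dual ν (l i)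
  have hstep1 : ∫ z, Finset.univ.sup' Finset.univ_nonempty
        (fun i => |inner ℝ (v i) (crossOp y z (v i))|) ∂ν
      ≤ ∫ z, Finset.univ.sup' Finset.univ_nonempty (fun i => l i z) ∂ν := by
    refine integral_mono (integrable_univ_sup' fun i => ?_) (integrable_univ_sup' hlint)
      fun z => Finset.sup'_le _ _ fun i _ => ?_
    · have := (hlint (i, true)).abs
      simpa [hl, sg] using this
    · rcases abs_choice (inner ℝ (v i) (crossOp y z (v i))) with h | h <;> rw [h]
      · refine le_trans (le_of_eq ?_)
          (Finset.le_sup' (fun i => l i z) (Finset.mem_univ (i, true)))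
        simp [hl, sg]
      · refine le_trans (le_of_eq ?_)
          (Finset.le_sup' (fun i => l i z) (Finset.mem_univ (i, false)))
        simp [hl, sg]
  set Q : F × EuclideanSpace ℝ κ → ℝ := fun x =>
    ‖crossOp y y‖ * ‖L.adjoint x.1‖ ^ 2 + b ^ 2 * ‖∑ i, x.2 i • y i‖ ^ 2
          + 2 * (√‖crossOp y y‖ * b) * |inner ℝ x.1 (L (∑ i, x.2 i • y i))| with hQ
  obtain ⟨iA, eA⟩ := integral_norm_adjoint_sq_stdGaussian e L
  obtain ⟨iN, eN⟩ := integral_norm_sum_smul_sq_stdGaussian y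
  have i1 : Integrable (fun x : F × EuclideanSpace ℝ κ => ‖crossOp y y‖ * ‖L.adjoint x.1‖ ^ 2) γ :=
    (iA.comp_fst _).const_mul _
  have i2 : Integrable (fun x : F × EuclideanSpace ℝ κ => b ^ 2 * ‖∑ i, x.2 i • y i‖ ^ 2) γ :=
    (iN.comp_snd _).const_mul _
  have i3 : Integrable (fun x : F × EuclideanSpace ℝ κ =>
      |inner ℝ x.1 (L (∑ i, x.2 i • y i))|) γ := by
    refine ((iA.comp_fst (stdGaussian (EuclideanSpace ℝ κ))).add
      (iN.comp_snd (stdGaussian F))).mono' ?_ (.of_forall fun x => ?_)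
    · exact (Measurable.aestronglyMeasurable (by fun_prop))
    · rw [← ContinuousLinearMap.adjoint_inner_left, Real.norm_eq_abs, abs_abs]
      refine (abs_real_inner_le_norm _ _).trans ?_
      simp only [Pi.add_apply]
      nlinarith [sq_nonneg (‖L.adjoint x.1‖ - ‖∑ i, x.2 i • y i‖),
        sq_nonneg ‖L.adjoint x.1‖, sq_nonneg ‖∑ i, x.2 i • y i‖]
  have iQ : Integrable Q γ := (i1.add i2).add (i3.const_mul _)
  have hQ0 : ∀ x, 0 ≤ Q x := fun x => by
    simp only [hQ]; positivity
  have hk1 : MemLp (fun g : EuclideanSpace ℝ κ => ‖∑ i, g i • y i‖) 2 (stdGaussian _) := by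
    rw [memLp_two_iff_integrable_sq (Measurable.aestronglyMeasurable (by fun_prop))]
    exact iN
  -- For fixed g the inner product with h is a centred Gaussian of standard deviation ‖L k‖ ≤ b‖k‖,
  -- where k = ∑ gᵢ yᵢ. Independence thus avoids the larger bound E‖L* h‖ E‖k‖.
  have h3 : ∫ x, |inner ℝ x.1 (L (∑ i, x.2 i • y i))| ∂γ ≤ b * √(∑ i, ‖y i‖ ^ 2) := by
    rw [integral_prod_symm _ i3]
    have hin : ∀ g : EuclideanSpace ℝ κ,
        ∫ h, |inner ℝ h (L (∑ i, g i • y i))| ∂stdGaussian F ≤ b * ‖∑ i, g i • y i‖ := by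
      intro g
      have := sq_integral_le_integral_sq (memLp_inner_stdGaussian (L (∑ i, g i • y i))).abs
      simp only [Pi.abs_apply, sq_abs, integral_inner_sq_stdGaussian] at this
      exact (le_of_sq_le_sq this (norm_nonneg _)).trans (hL _)
    refine (integral_mono i3.integral_prod_right ((hk1.integrable (by norm_num)).const_mul b)
      hin).trans ?_
    rw [integral_const_mul]
    refine mul_le_mul_of_nonneg_left (Real.le_sqrt_of_sq_le ?_) hb
    exact (sq_integral_le_integral_sq hk1).trans eN.le
  have hQint : ∫ x, Q x ∂γ ≤ ‖crossOp y y‖ * A + b ^ 2 * ∑ i, ‖y i‖ ^ 2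
          + 2 * (√‖crossOp y y‖ * b) * (b * √(∑ i, ‖y i‖ ^ 2)) := by
    simp only [hQ]
    rw [integral_add (i1.fun_add i2) (i3.const_mul _), integral_add i1 i2, integral_const_mul,
      integral_const_mul, integral_const_mul, integral_fun_fst (fun h => ‖L.adjoint h‖ ^ 2),
      integral_fun_snd (fun g : EuclideanSpace ℝ κ => ‖∑ i, g i • y i‖ ^ 2), eA, eN]
    simp only [probReal_univ, one_smul]
    gcongr
  refine hstep1.trans (hcomp.trans ?_)
  refine le_trans (integral_mono ?_ ?_ (fun x => Finset.sup'_le _ _ fun i _ =>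
    comparison_le_sqrt y hL (hv i.1) (hsg i.2) x.1 x.2)) ?_
  · refine integrable_univ_sup' fun i => ?_
    have j1 := (memLp_inner_stdGaussian (L (sg i.2 • v i.1))).integrable (by norm_num)
    have j2 := (memLp_inner_stdGaussian (coeffs y (v i.1))).integrable (by norm_num)
    exact ((j1.comp_fst _).const_mul _).add ((j2.comp_snd _).const_mul _)
  · have : MemLp (fun x => √(Q x)) 2 γ := by
      rw [memLp_two_iff_integrable_sq (Real.continuous_sqrt.comp_aestronglyMeasurable iQ.1)]
      simpa only [Real.sq_sqrt (hQ0 _)] using iQ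
    exact this.integrable (by norm_num)
  · exact (integral_sqrt_le_sqrt_integral iQ hQ0).trans (Real.sqrt_le_sqrt hQint)

end Chaos

/-! ### Norms of symmetric operators by quadratic forms on a finite net. -/

/-- Polarization writes 4⟨u, Qv⟩ as a difference of quadratic forms at u ± v, and the parallelogram
law gives ‖u + v‖² + ‖u − v‖² = 4 for unit vectors, so no constant is lost. -/
theorem ContinuousLinearMap.opNorm_le_of_abs_inner_self_le {E : Type*} [NormedAddCommGroup E]
    [InnerProductSpace ℝ E] {Q : E →L[ℝ] E} (hQ : ∀ u v, inner ℝ u (Q v) = inner ℝ v (Q u))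
    {c : ℝ} (hc : 0 ≤ c) (h : ∀ u, ‖u‖ = 1 → |inner ℝ u (Q u)| ≤ c) : ‖Q‖ ≤ c := by
  have h' : ∀ u, |inner ℝ u (Q u)| ≤ c * ‖u‖ ^ 2 := by
    intro u
    by_cases hu : u = 0
    · simp [hu]
    have hn : ‖u‖ ≠ 0 := norm_ne_zero_iff.2 hu
    have := h (‖u‖⁻¹ • u) (by rw [norm_smul, norm_inv, norm_norm, inv_mul_cancel₀ hn])
    rw [map_smul, inner_smul_left, inner_smul_right, conj_trivial, ← mul_assoc, abs_mul,
      abs_of_nonneg (by positivity : (0 : ℝ) ≤ ‖u‖⁻¹ * ‖u‖⁻¹)] at this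
    calc |inner ℝ u (Q u)| = ‖u‖⁻¹ * ‖u‖⁻¹ * |inner ℝ u (Q u)| * ‖u‖ ^ 2 := by field_simp
      _ ≤ _ := mul_le_mul_of_nonneg_right this (sq_nonneg _)
  have hpol : ∀ u v, ‖u‖ = 1 → ‖v‖ = 1 → inner ℝ u (Q v) ≤ c := by
    intro u v hu hv
    have e : 4 * inner ℝ u (Q v) = inner ℝ (u + v) (Q (u + v)) - inner ℝ (u - v) (Q (u - v)) := by
      simp only [map_add, map_sub, inner_add_left, inner_add_right, inner_sub_left,
        inner_sub_right]
      rw [hQ v u]; ring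
    have h1 := (abs_le.1 (h' (u + v))).2
    have h2 := (abs_le.1 (h' (u - v))).1
    have h3 : ‖u + v‖ ^ 2 + ‖u - v‖ ^ 2 = 4 := by
      rw [norm_add_sq_real, norm_sub_sq_real, hu, hv]; ring
    nlinarith
  refine Q.opNorm_le_of_unit_norm hc fun v hv => ?_
  by_cases hQv : Q v = 0
  · simpa [hQv] using hc
  have hn : ‖Q v‖ ≠ 0 := norm_ne_zero_iff.2 hQv
  have := hpol (‖Q v‖⁻¹ • Q v) v (by rw [norm_smul, norm_inv, norm_norm, inv_mul_cancel₀ hn]) hv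
  rw [inner_smul_left, real_inner_self_eq_norm_sq, conj_trivial, sq, ← mul_assoc,
    inv_mul_cancel₀ hn, one_mul] at this
  exact this

theorem exists_net_unit_sphere {E : Type*} [NormedAddCommGroup E] [InnerProductSpace ℝ E]
    [FiniteDimensional ℝ E] [Nontrivial E] {δ : ℝ} (hδ : 0 < δ) :
    ∃ t : Finset E, t.Nonempty ∧ (∀ v ∈ t, ‖v‖ = 1) ∧ ∀ u : E, ‖u‖ = 1 → ∃ v ∈ t, ‖u - v‖ < δ := by
  obtain ⟨t, ht, hfin, hcov⟩ := (isCompact_sphere (0 : E) 1).finite_cover_balls hδ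
  obtain ⟨u, hu⟩ := exists_norm_eq (E := E) zero_le_one
  have hc : ∀ u : E, ‖u‖ = 1 → ∃ v ∈ hfin.toFinset, ‖u - v‖ < δ := by
    intro u hu
    have : u ∈ Metric.sphere (0 : E) 1 := by simpa using hu
    obtain ⟨v, hv, huv⟩ := Set.mem_iUnion₂.1 (hcov this)
    exact ⟨v, hfin.mem_toFinset.2 hv, by simpa [dist_eq_norm] using huv⟩
  obtain ⟨v, hv, -⟩ := hc u hu
  exact ⟨hfin.toFinset, ⟨v, hv⟩, fun v hv => by simpa using ht (hfin.mem_toFinset.1 hv), hc⟩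

/-- Moving u to a net point changes the quadratic form by at most 2δ‖Q‖, which is absorbed on the
left. The net makes the supremum a finite maximum, as the comparison theorem requires. -/
theorem ContinuousLinearMap.opNorm_le_of_net {E : Type*} [NormedAddCommGroup E]
    [InnerProductSpace ℝ E] {Q : E →L[ℝ] E} (hQ : ∀ u v, inner ℝ u (Q v) = inner ℝ v (Q u))
    {t : Finset E} {δ : ℝ} (ht : ∀ v ∈ t, ‖v‖ = 1)
    (hnet : ∀ u : E, ‖u‖ = 1 → ∃ v ∈ t, ‖u - v‖ < δ) {m : ℝ} (hm : 0 ≤ m) (hδ : 0 ≤ δ)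
    (h : ∀ v ∈ t, |inner ℝ v (Q v)| ≤ m) : (1 - 2 * δ) * ‖Q‖ ≤ m := by
  have : ‖Q‖ ≤ m + 2 * δ * ‖Q‖ := by
    refine opNorm_le_of_abs_inner_self_le hQ (by positivity) fun u hu => ?_
    obtain ⟨v, hv, huv⟩ := hnet u hu
    have e : inner ℝ u (Q u) = inner ℝ v (Q v) + (inner ℝ (u - v) (Q u) + inner ℝ v (Q (u - v))) := by
      simp only [map_sub, inner_sub_left, inner_sub_right]; ring
    have h1 : |inner ℝ (u - v) (Q u)| ≤ δ * ‖Q‖ := by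
      refine (abs_real_inner_le_norm _ _).trans ?_
      refine mul_le_mul huv.le ?_ (norm_nonneg _) hδ
      simpa [hu] using Q.le_opNorm u
    have h2 : |inner ℝ v (Q (u - v))| ≤ δ * ‖Q‖ := by
      refine (abs_real_inner_le_norm _ _).trans ?_
      rw [ht v hv, one_mul, mul_comm]
      exact (Q.le_opNorm _).trans (mul_le_mul_of_nonneg_left huv.le (norm_nonneg _))
    rw [e]
    refine (abs_add_le _ _).trans ?_
    have h3 := abs_add_le (inner ℝ (u - v) (Q u)) (inner ℝ v (Q (u - v)))
    linarith [h v hv]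
  linarith

theorem integral_sqrt_mul_sqrt_le {Ω : Type*} [MeasurableSpace Ω] {P : Measure Ω}
    {f g : Ω → ℝ} (hf : Integrable f P) (hg : Integrable g P)
    (hf0 : ∀ ω, 0 ≤ f ω) (hg0 : ∀ ω, 0 ≤ g ω) :
    Integrable (fun ω => √(f ω) * √(g ω)) P ∧
    ∫ ω, √(f ω) * √(g ω) ∂P ≤ √(∫ ω, f ω ∂P) * √(∫ ω, g ω ∂P) := by
  have hL : ∀ f : Ω → ℝ, Integrable f P → (∀ ω, 0 ≤ f ω) → MemLp (fun ω => √(f ω)) 2 P := by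
    intro f hf h0
    rw [memLp_two_iff_integrable_sq (Real.continuous_sqrt.comp_aestronglyMeasurable hf.1)]
    simpa only [Real.sq_sqrt (h0 _)] using hf
  refine ⟨(hL f hf hf0).integrable_mul (hL g hg hg0), ?_⟩
  have := integral_mul_le_Lp_mul_Lq_of_nonneg (μ := P) Real.HolderConjugate.two_two
    (.of_forall fun ω => Real.sqrt_nonneg (f ω)) (.of_forall fun ω => Real.sqrt_nonneg (g ω))
    (by simpa using hL f hf hf0) (by simpa using hL g hg hg0)
  simpa [Real.sqrt_eq_rpow, ← Real.rpow_natCast, ← Real.rpow_mul (hf0 _),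
    ← Real.rpow_mul (hg0 _)] using this

theorem continuous_crossOp {κ E : Type*} [Fintype κ] [NormedAddCommGroup E]
    [InnerProductSpace ℝ E] : Continuous fun x : (κ → E) × (κ → E) => crossOp x.1 x.2 := by
  unfold crossOp
  fun_prop

/-! ### Decoupling and the bound averaged over both copies. -/

section Decoupling

variable {κ E F : Type*} [Fintype κ]
  [NormedAddCommGroup E] [InnerProductSpace ℝ E] [FiniteDimensional ℝ E]
  [MeasurableSpace E] [BorelSpace E]
  [NormedAddCommGroup F] [InnerProductSpace ℝ F] [FiniteDimensional ℝ F]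
  [MeasurableSpace F] [BorelSpace F]

theorem integrable_norm_sq_eval {ν : Measure (κ → E)} [IsGaussian ν] (i : κ) :
    Integrable (fun y : κ → E => ‖y i‖ ^ 2) ν := by
  have h : HasGaussianLaw (fun y : κ → E => y i) ν :=
    (IsGaussian.hasGaussianLaw_id (μ := ν)).map_fun (ContinuousLinearMap.proj (R := ℝ) i)
  exact h.memLp_two.integrable_norm_pow (by norm_num)

theorem integrable_crossOp_self {ν : Measure (κ → E)} [IsGaussian ν] :
    Integrable (fun y => crossOp y y) ν := by
  refine (integrable_finsetSum Finset.univ fun i _ => integrable_norm_sq_eval (ν := ν) i).mono'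
    (continuous_crossOp.comp (by fun_prop : Continuous fun y : κ → E => (y, y))).aestronglyMeasurable
    (.of_forall fun y => ?_)
  simpa [sq] using norm_crossOp_le y y

/-- Jensen replaces the mean by an independent copy. A centred Gaussian product law is invariant
under rotation by π/4, and the identity (y+z)⊗(y+z) − (z−y)⊗(z−y) = 2(y⊗z + z⊗y), with the factor
1/2 from the rotation, makes the difference bilinear. -/
theorem integral_norm_crossOp_sub_integral_le {ν : Measure (κ → E)} [IsGaussian ν]
    (hν : ∫ y, y ∂ν = 0) :
    ∫ y, ‖crossOp y y - ∫ z, crossOp z z ∂ν‖ ∂ν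
      ≤ ∫ x, ‖crossOp x.1 x.2 + crossOp x.2 x.1‖ ∂(ν.prod ν) := by
  have hS := integrable_crossOp_self (ν := ν)
  have hint : Integrable (fun x : (κ → E) × (κ → E) => crossOp x.1 x.1 - crossOp x.2 x.2)
      (ν.prod ν) := (hS.comp_fst ν).sub (hS.comp_snd ν)
  have h1 : ∫ y, ‖crossOp y y - ∫ z, crossOp z z ∂ν‖ ∂ν
      ≤ ∫ x, ‖crossOp x.1 x.1 - crossOp x.2 x.2‖ ∂(ν.prod ν) := by
    rw [integral_prod _ hint.norm]
    refine integral_mono (hS.sub (integrable_const _)).norm hint.norm.integral_prod_left fun y => ?_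
    have : crossOp y y - ∫ z, crossOp z z ∂ν = ∫ z, (crossOp y y - crossOp z z) ∂ν := by
      rw [integral_sub (integrable_const _) hS]; simp
    simp only [this]
    exact norm_integral_le_integral_norm _
  refine h1.trans (le_of_eq ?_)
  have hrot := IsGaussian.map_rotation_eq_self (μ := ν) (by simpa using hν) (Real.pi / 4)
  conv_lhs => rw [← hrot]
  rw [integral_map (by fun_prop)]
  · congr 1; ext x
    congr 1; ext v
    have hs : Real.sin (Real.pi / 4) * Real.sin (Real.pi / 4) = 1 / 2 := by
      rw [Real.sin_pi_div_four]; nlinarith [Real.sq_sqrt (show (0 : ℝ) ≤ 2 by norm_num)]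
    have hc : Real.cos (Real.pi / 4) = Real.sin (Real.pi / 4) := by
      rw [Real.sin_pi_div_four, Real.cos_pi_div_four]
    simp only [ContinuousLinearMap.rotation_apply, hc, sub_apply,
      add_apply, crossOp_apply, ← Finset.sum_sub_distrib,
      ← Finset.sum_add_distrib]
    refine Finset.sum_congr rfl fun i _ => ?_
    simp only [Pi.add_apply, Pi.smul_apply, Pi.neg_apply, inner_add_left, inner_smul_left,
      conj_trivial, neg_smul, inner_neg_left]
    set σ := Real.sin (Real.pi / 4)
    set p := inner ℝ (x.1 i) v
    set q := inner ℝ (x.2 i) v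
    have : (σ * p + σ * q) • (σ • x.1 i + σ • x.2 i) - (-(σ * p) + σ * q) • (-(σ • x.1 i) + σ • x.2 i)
        = (2 * (σ * σ)) • (p • x.2 i + q • x.1 i) := by module
    rw [this, hs]
    norm_num
  · refine Continuous.aestronglyMeasurable (Continuous.norm ?_)
    exact (continuous_crossOp.comp (by fun_prop : Continuous fun x : (κ → E) × (κ → E) => (x.1, x.1))).sub
      (continuous_crossOp.comp (by fun_prop : Continuous fun x : (κ → E) × (κ → E) => (x.2, x.2)))

/-- Condition on y, apply the comparison in z over a net of the sphere, let the mesh tend to zero,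
and average over y with Jensen for the square root and Cauchy–Schwarz for the mixed term. -/
theorem integral_norm_crossOp_add_le [Nontrivial E] {J : Type*} [Fintype J]
    {ν : Measure (κ → E)} [IsGaussian ν] (hν : ∫ y, y ∂ν = 0)
    (e : OrthonormalBasis J ℝ E) {L : E →L[ℝ] F} {A b : ℝ} (hb : 0 ≤ b)
    (hL : ∀ u, ‖L u‖ ≤ b * ‖u‖) (hA : ∑ j, ‖L (e j)‖ ^ 2 ≤ A)
    (hK : ∀ w : κ → E, ∫ z, (∑ i, inner ℝ (w i) (z i)) ^ 2 ∂ν ≤ ∑ i, ‖L (w i)‖ ^ 2) :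
    ∫ x, ‖crossOp x.1 x.2 + crossOp x.2 x.1‖ ∂(ν.prod ν)
      ≤ 2 * √(A * ∫ y, ‖crossOp y y‖ ∂ν + b ^ 2 * ∫ y, ∑ i, ‖y i‖ ^ 2 ∂ν
          + 2 * b ^ 2 * (√(∫ y, ‖crossOp y y‖ ∂ν) * √(∫ y, ∑ i, ‖y i‖ ^ 2 ∂ν))) := by
  have hA0 : 0 ≤ A := (Finset.sum_nonneg fun _ _ => sq_nonneg _).trans hA
  have hν' : ∀ l : StrongDual ℝ (κ → E), ∫ z, l z ∂ν = 0 := fun l => by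
    rw [IsGaussian.integral_dual, hν, map_zero]
  have hS := (integrable_crossOp_self (ν := ν)).norm
  have hN : Integrable (fun y : κ → E => ∑ i, ‖y i‖ ^ 2) ν :=
    integrable_finsetSum _ fun i _ => integrable_norm_sq_eval i
  obtain ⟨hSN, hSN'⟩ := integral_sqrt_mul_sqrt_le hS hN (fun _ => norm_nonneg _)
    (fun _ => Finset.sum_nonneg fun _ _ => sq_nonneg _)
  set q : (κ → E) → ℝ := fun y => ‖crossOp y y‖ * A + b ^ 2 * ∑ i, ‖y i‖ ^ 2
          + 2 * b ^ 2 * (√‖crossOp y y‖ * √(∑ i, ‖y i‖ ^ 2)) with hq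
  have i1 := hS.mul_const A
  have i2 := hN.const_mul (b ^ 2)
  have hqi : Integrable q ν := (i1.add i2).add (hSN.const_mul _)
  have hq0 : ∀ y, 0 ≤ q y := fun y => by simp only [hq]; positivity
  have hqint : ∫ y, q y ∂ν ≤ A * ∫ y, ‖crossOp y y‖ ∂ν + b ^ 2 * ∫ y, ∑ i, ‖y i‖ ^ 2 ∂ν
          + 2 * b ^ 2 * (√(∫ y, ‖crossOp y y‖ ∂ν) * √(∫ y, ∑ i, ‖y i‖ ^ 2 ∂ν)) := by
    simp only [hq]
    rw [integral_add (i1.fun_add i2) (hSN.const_mul _), integral_add i1 i2, integral_const_mul,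
      integral_mul_const, integral_const_mul, mul_comm A]
    gcongr
  have hsq : Integrable (fun y => √(q y)) ν := by
    have : MemLp (fun x => √(q x)) 2 ν := by
      rw [memLp_two_iff_integrable_sq (Real.continuous_sqrt.comp_aestronglyMeasurable hqi.1)]
      simpa only [Real.sq_sqrt (hq0 _)] using hqi
    exact this.integrable (by norm_num)
  have hyz : Integrable (fun x : (κ → E) × (κ → E) => crossOp x.1 x.2 + crossOp x.2 x.1)
      (ν.prod ν) := by
    refine ((hN.comp_fst ν).add (hN.comp_snd ν)).mono' ?_ (.of_forall fun x => ?_)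
    · exact (continuous_crossOp.add (continuous_crossOp.comp continuous_swap)).aestronglyMeasurable
    · refine (norm_add_le _ _).trans ((add_le_add (norm_crossOp_le _ _) (norm_crossOp_le _ _)).trans ?_)
      simp only [Pi.add_apply, ← Finset.sum_add_distrib]
      exact Finset.sum_le_sum fun i _ => by nlinarith [sq_nonneg (‖x.1 i‖ - ‖x.2 i‖)]
  have hnet : ∀ δ : ℝ, 0 < δ →
      (1 - 2 * δ) * ∫ x, ‖crossOp x.1 x.2 + crossOp x.2 x.1‖ ∂(ν.prod ν)
        ≤ 2 * ∫ y, √(q y) ∂ν := by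
    intro δ hδ
    obtain ⟨t, htne, ht, hcov⟩ := exists_net_unit_sphere (E := E) hδ
    have : Nonempty t := htne.to_subtype
    let m : (κ → E) × (κ → E) → ℝ := fun x => Finset.univ.sup' Finset.univ_nonempty
      (fun i : t => |inner ℝ (i : E) (crossOp x.1 x.2 (i : E))|)
    -- The two summands are adjoint to each other and share the same quadratic form; this is the
    -- source of the factor 2 in the bound.
    have hself : ∀ (x : (κ → E) × (κ → E)) (u : E), inner ℝ u ((crossOp x.1 x.2 + crossOp x.2 x.1) u)
        = 2 * inner ℝ u (crossOp x.1 x.2 u) := by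
      intro x u
      rw [add_apply, inner_add_right, inner_crossOp, inner_crossOp, two_mul]
      congr 1
      exact Finset.sum_congr rfl fun i _ => by
        rw [real_inner_comm (x.1 i), real_inner_comm u, mul_comm]
    have hmint : Integrable m (ν.prod ν) := by
      refine integrable_univ_sup' fun i => ?_
      have : Integrable (fun x : (κ → E) × (κ → E) =>
          2⁻¹ * inner ℝ (i : E) ((crossOp x.1 x.2 + crossOp x.2 x.1) i)) (ν.prod ν) :=
        ((hyz.apply_continuousLinearMap (i : E)).const_inner (i : E)).const_mul _
      simp only [hself, inv_mul_cancel_left₀ (two_ne_zero' ℝ)] at this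
      exact this.abs
    have hpt : ∀ x, (1 - 2 * δ) * ‖crossOp x.1 x.2 + crossOp x.2 x.1‖ ≤ 2 * m x := by
      intro x
      have hle : ∀ i : t, |inner ℝ (i : E) (crossOp x.1 x.2 (i : E))| ≤ m x := fun i =>
        Finset.le_sup' (fun i : t => |inner ℝ (i : E) (crossOp x.1 x.2 (i : E))|) (Finset.mem_univ i)
      have hm0 : 0 ≤ m x := (abs_nonneg _).trans (hle (Classical.arbitrary t))
      refine ContinuousLinearMap.opNorm_le_of_net (fun u v => ?_) ht hcov (by positivity) hδ.le
        fun v hv => ?_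
      · simp only [add_apply, inner_add_right, inner_crossOp]
        rw [add_comm]
        congr 1 <;> exact Finset.sum_congr rfl fun i _ => by
          rw [real_inner_comm u, real_inner_comm v, mul_comm]
      · rw [hself, abs_mul, abs_two]
        exact mul_le_mul_of_nonneg_left (hle ⟨v, hv⟩) zero_le_two
    rw [← integral_const_mul, ← integral_const_mul]
    calc ∫ x, (1 - 2 * δ) * ‖crossOp x.1 x.2 + crossOp x.2 x.1‖ ∂(ν.prod ν)
        ≤ ∫ x, 2 * m x ∂(ν.prod ν) := integral_mono (hyz.norm.const_mul _) (hmint.const_mul _) hpt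
      _ = ∫ y, ∫ z, 2 * m (y, z) ∂ν ∂ν := integral_prod _ (hmint.const_mul _)
      _ ≤ ∫ y, 2 * √(q y) ∂ν := by
          refine integral_mono (hmint.const_mul 2).integral_prod_left (hsq.const_mul 2) fun y => ?_
          simp only [integral_const_mul]
          refine mul_le_mul_of_nonneg_left ?_ zero_le_two
          refine (integral_sup'_abs_inner_crossOp_le hν' e hb hL hA hK y
            (v := fun i : t => (i : E)) fun i => ht i i.2).trans (le_of_eq ?_)
          congr 1
          simp only [hq]; ring
  have hlim : ∫ x, ‖crossOp x.1 x.2 + crossOp x.2 x.1‖ ∂(ν.prod ν) ≤ 2 * ∫ y, √(q y) ∂ν := by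
    set I := ∫ x, ‖crossOp x.1 x.2 + crossOp x.2 x.1‖ ∂(ν.prod ν)
    have hI : 0 ≤ I := integral_nonneg fun _ => norm_nonneg _
    refine le_of_forall_pos_le_add fun ε hε => ?_
    -- This mesh makes the loss 2δI at most ε; the added 1 covers I = 0.
    have := hnet (ε / (2 * (I + 1))) (by positivity)
    have e2 : 2 * (ε / (2 * (I + 1))) * I ≤ ε := by
      rw [mul_div_assoc', mul_div_mul_left _ _ two_ne_zero, div_mul_eq_mul_div,
        div_le_iff₀ (by positivity)]
      nlinarith
    linarith
  refine hlim.trans (mul_le_mul_of_nonneg_left ?_ zero_le_two)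
  exact (integral_sqrt_le_sqrt_integral hqi hq0).trans (Real.sqrt_le_sqrt hqint)

end Decoupling

/-! ### The self-bounding inequality. -/

/-- On [0, 1] the concave function β(2y − β) is largest at β = y, with value y², when y ≤ 1, and at
β = 1, with value 2y − 1, when y ≥ 1. The rest is a polynomial inequality in y. It is the scale-free
form of the estimate `key` in `le_of_self_bound`. -/
theorem sq_mul_sq_ge_aux {y β : ℝ} (hy : 0 ≤ y) (hβ0 : 0 ≤ β) (hβ1 : β ≤ 1) (hβy : β ≤ 2 * y) :
    2 * (1 + y) * (β * (2 * y - β)) ^ 2 ≤ y ^ 2 * (y + 2) ^ 2 := by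
  have h0 : 0 ≤ β * (2 * y - β) := mul_nonneg hβ0 (by linarith)
  rcases le_total y 1 with h1 | h1
  · have : β * (2 * y - β) ≤ y ^ 2 := by nlinarith [sq_nonneg (y - β)]
    have h2 : (β * (2 * y - β)) ^ 2 ≤ (y ^ 2) ^ 2 := pow_le_pow_left₀ h0 this 2
    have h3 : 2 * (1 + y) * (y ^ 2) ^ 2 ≤ y ^ 2 * (y + 2) ^ 2 := by
      have : 2 * (1 + y) * y ^ 2 ≤ (y + 2) ^ 2 := by nlinarith [mul_nonneg hy hy]
      nlinarith [mul_le_mul_of_nonneg_left this (sq_nonneg y)]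
    nlinarith
  · have : β * (2 * y - β) ≤ 2 * y - 1 := by nlinarith
    have h2 : (β * (2 * y - β)) ^ 2 ≤ (2 * y - 1) ^ 2 := pow_le_pow_left₀ h0 this 2
    have h3 : 2 * (1 + y) * (2 * y - 1) ^ 2 ≤ y ^ 2 * (y + 2) ^ 2 := by
      nlinarith [sq_nonneg (y * (y - 2))]
    nlinarith

/-- Solving the self-bounding inequality for `r`, with `A = a²`. -/
theorem le_of_self_bound {a b s t r : ℝ} (ha : 0 < a) (hb : 0 ≤ b) (hs : 0 ≤ s) (ht : 0 ≤ t)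
    (hr : 0 ≤ r) (hba : b ≤ a) (hbs : b ≤ √2 * s)
    (h : r ^ 2 ≤ a ^ 2 * (s ^ 2 + 2 * r) + b ^ 2 * t ^ 2 + 2 * b ^ 2 * (√(s ^ 2 + 2 * r) * t)) :
    r ≤ 2 * a ^ 2 + √2 * (a * s) + √2 * (b * t) := by
  have h2 : √2 * √2 = 2 := Real.mul_self_sqrt (by norm_num)
  have hq : 0 < √2 := by positivity
  set z := a * s + b * t with hz
  have hbt : 0 ≤ b * t := mul_nonneg hb ht
  have has : 0 ≤ a * s := mul_nonneg ha.le hs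
  set R := 2 * a ^ 2 + √2 * z with hR
  have hRe : 2 * a ^ 2 + √2 * (a * s) + √2 * (b * t) = R := by rw [hR, hz]; ring
  rw [hRe]
  have hRpos : 0 < R := by positivity
  by_contra! hlt
  -- linearize the square root at `R`
  set ℓ := √(2 * R) with hℓ
  have hℓpos : 0 < ℓ := by positivity
  have hℓsq : ℓ * ℓ = 2 * R := Real.mul_self_sqrt (by positivity)
  have hsqrt : √(s ^ 2 + 2 * r) ≤ s + √(2 * r) := by
    refine Real.sqrt_le_iff.2 ⟨by positivity, ?_⟩
    have := Real.sq_sqrt (show 0 ≤ 2 * r by positivity)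
    nlinarith [mul_nonneg hs (Real.sqrt_nonneg (2 * r))]
  have key : 2 * b * (b * t) * ℓ ≤ z ^ 2 + 2 * √2 * a ^ 2 * z := by
    -- the bound at `R`
    set y := z / (√2 * a ^ 2) with hy
    set β := b / a with hβ
    have hzy : z = √2 * a ^ 2 * y := by rw [hy]; field_simp
    have hbβ : b = β * a := by rw [hβ]; field_simp
    have hy0 : 0 ≤ y := by positivity
    have hβ0 : 0 ≤ β := by positivity
    have hβ1 : β ≤ 1 := by rw [hβ, div_le_one ha]; exact hba
    -- A lower bound on s keeps bt = z − as away from z; this yields the factor 2y − β instead of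
    -- 2y.
    have hsb : b * √2 ≤ 2 * s := by nlinarith
    have hbt' : b * t ≤ √2 * a ^ 2 * y - a * (b * √2) / 2 := by
      rw [← hzy, hz]
      nlinarith [mul_le_mul_of_nonneg_left hsb ha.le]
    have hbt2 : √2 * (b * t) ≤ a ^ 2 * (2 * y - β) := by
      have := mul_le_mul_of_nonneg_left hbt' hq.le
      have e : √2 * (√2 * a ^ 2 * y - a * (b * √2) / 2) = a ^ 2 * (2 * y - β) := by
        rw [hbβ]; linear_combination (a ^ 2 * y - a ^ 2 * β / 2) * h2
      linarith
    have hβy : β ≤ 2 * y := by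
      have : 0 ≤ a ^ 2 * (2 * y - β) := le_trans (by positivity) hbt2
      have := nonneg_of_mul_nonneg_right this (by positivity)
      linarith
    have haux := sq_mul_sq_ge_aux hy0 hβ0 hβ1 hβy
    have hRy : R = 2 * a ^ 2 * (1 + y) := by
      rw [hR, hzy]; linear_combination (a ^ 2 * y) * h2
    have hrhs : z ^ 2 + 2 * √2 * a ^ 2 * z = 2 * a ^ 4 * (y * (y + 2)) := by
      rw [hzy]; linear_combination (a ^ 4 * y ^ 2 + 2 * a ^ 4 * y) * h2
    rw [hrhs]
    refine le_of_sq_le_sq ?_ (by positivity)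
    have hm : (√2 * (b * t)) ^ 2 ≤ (a ^ 2 * (2 * y - β)) ^ 2 :=
      pow_le_pow_left₀ (by positivity) hbt2 2
    calc (2 * b * (b * t) * ℓ) ^ 2
        = 2 * b ^ 2 * (√2 * (b * t)) ^ 2 * (ℓ * ℓ) := by
          linear_combination (-(2 * b ^ 2 * (b * t) ^ 2 * (ℓ * ℓ))) * h2
      _ ≤ 2 * b ^ 2 * (a ^ 2 * (2 * y - β)) ^ 2 * (ℓ * ℓ) := by gcongr
      _ = 4 * a ^ 8 * (2 * (1 + y) * (β * (2 * y - β)) ^ 2) := by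
          rw [hℓsq, hRy, hbβ]; ring
      _ ≤ 4 * a ^ 8 * (y ^ 2 * (y + 2) ^ 2) := by gcongr
      _ = (2 * a ^ 4 * (y * (y + 2))) ^ 2 := by ring
  have hlin : √(2 * r) * ℓ ≤ r + R := by
    have := Real.sq_sqrt (show 0 ≤ 2 * r by positivity)
    nlinarith [sq_nonneg (√(2 * r) - ℓ)]
  -- Replacing one b by a lets the cross term complete the square (as + bt)² = z².
  have hba2 : b * s * (b * t) ≤ a * s * (b * t) :=
    mul_le_mul_of_nonneg_right (mul_le_mul_of_nonneg_right hba hs) hbt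
  have hc0 : 0 ≤ 2 * b * (b * t) := by positivity
  have h' : r ^ 2 ≤ a ^ 2 * (s ^ 2 + 2 * r) + (b * t) ^ 2 + 2 * (a * s * (b * t))
      + 2 * b * (b * t) * √(2 * r) := by
    have : 2 * b ^ 2 * (√(s ^ 2 + 2 * r) * t) ≤ 2 * b * (b * t) * (s + √(2 * r)) := by
      have := mul_le_mul_of_nonneg_left hsqrt hc0
      linarith only [this]
    linarith only [this, h, hba2]
  -- multiply by `ℓ²` to remove the root
  have hfin : 2 * b * (b * t) * √(2 * r) * (2 * R) ≤ (z ^ 2 + 2 * √2 * a ^ 2 * z) * (r + R) := by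
    rw [← hℓsq]
    have h1 := mul_le_mul_of_nonneg_left hlin (mul_nonneg hc0 hℓpos.le)
    have h2 := mul_le_mul_of_nonneg_right key (by positivity : 0 ≤ r + R)
    linarith only [h1, h2]
  set c := z ^ 2 + 2 * √2 * a ^ 2 * z with hc
  -- R² − 2a²R = z² + c: here c is the allowance left for the square-root term, and `key` says that
  -- this term at r = R fits into it.
  have hRR : R ^ 2 = 2 * a ^ 2 * R + a ^ 2 * s ^ 2 + (b * t) ^ 2 + 2 * (a * s * (b * t)) + c := by
    rw [hc, hR, hz]; linear_combination (a * s + b * t) ^ 2 * h2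
  have hfin' : 2 * R * r ^ 2 ≤ 2 * R * (a ^ 2 * (s ^ 2 + 2 * r) + (b * t) ^ 2
      + 2 * (a * s * (b * t))) + c * (r + R) := by
    have := mul_le_mul_of_nonneg_left h' (by positivity : 0 ≤ 2 * R)
    linarith only [this, hfin]
  -- contradiction: the quadratic is positive beyond `R`
  have hcR : c ≤ R ^ 2 - 2 * a ^ 2 * R := by
    have : 0 ≤ a ^ 2 * s ^ 2 + (b * t) ^ 2 + 2 * (a * s * (b * t)) := by positivity
    linarith only [this, hRR]
  have hid : 2 * R * (a ^ 2 * (s ^ 2 + 2 * r) + (b * t) ^ 2 + 2 * (a * s * (b * t)))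
      + c * (r + R) - 2 * R * r ^ 2 = (r - R) * (4 * R * a ^ 2 + c - 2 * R * (r + R)) := by
    linear_combination (-(2 * R)) * hRR
  have hneg : 4 * R * a ^ 2 + c - 2 * R * (r + R) < 0 := by
    have ha2 : 2 * a ^ 2 ≤ R := by
      have : 0 ≤ √2 * z := by positivity
      linarith only [this, hR]
    have h3 := mul_pos hRpos (sub_pos.2 hlt)
    have h4 := mul_nonneg hRpos.le (sub_nonneg.2 ha2)
    have h5 := mul_pos hRpos hRpos
    linarith only [h3, h4, h5, hcR]
  have := mul_neg_of_pos_of_neg (sub_pos.2 hlt) hneg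
  linarith only [this, hid, hfin']

/-- Deviation of a Gaussian sample covariance operator from its mean, when the covariance of the
sample is dominated, coordinate by coordinate, by `L`. -/
theorem integral_norm_crossOp_sub_integral_le_of_dominated {κ E F J : Type*} [Fintype κ] [Fintype J]
    [NormedAddCommGroup E] [InnerProductSpace ℝ E] [FiniteDimensional ℝ E]
    [MeasurableSpace E] [BorelSpace E] [Nontrivial E]
    [NormedAddCommGroup F] [InnerProductSpace ℝ F] [FiniteDimensional ℝ F]
    [MeasurableSpace F] [BorelSpace F]
    {ν : Measure (κ → E)} [IsGaussian ν] (hν : ∫ y, y ∂ν = 0)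
    (e : OrthonormalBasis J ℝ E) {L : E →L[ℝ] F} {a b s t : ℝ}
    (hb : 0 ≤ b) (hs : 0 ≤ s) (ht : 0 ≤ t) (hba : b ≤ a) (hbs : b ≤ √2 * s)
    (hL : ∀ u, ‖L u‖ ≤ b * ‖u‖) (hA : ∑ j, ‖L (e j)‖ ^ 2 ≤ a ^ 2)
    (hK : ∀ w : κ → E, ∫ z, (∑ i, inner ℝ (w i) (z i)) ^ 2 ∂ν ≤ ∑ i, ‖L (w i)‖ ^ 2)
    (hC : ‖∫ y, crossOp y y ∂ν‖ ≤ s ^ 2) (hN : ∫ y, ∑ i, ‖y i‖ ^ 2 ∂ν ≤ t ^ 2) :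
    ∫ y, ‖crossOp y y - ∫ z, crossOp z z ∂ν‖ ∂ν
      ≤ 2 * (2 * a ^ 2 + √2 * (a * s) + √2 * (b * t)) := by
  have hS := integrable_crossOp_self (ν := ν)
  set C := ∫ z, crossOp z z ∂ν with hCdef
  set I := ∫ y, ‖crossOp y y - C‖ ∂ν with hI
  have hI0 : 0 ≤ I := integral_nonneg fun _ => norm_nonneg _
  -- The triangle inequality around C closes the loop: the deviation I reappears on the right, and r
  -- = I/2 is the unknown of the scalar inequality.
  have hx : ∫ y, ‖crossOp y y‖ ∂ν ≤ s ^ 2 + 2 * (I / 2) := by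
    have hd : Integrable (fun y => ‖crossOp y y - C‖) ν := (hS.sub (integrable_const C)).norm
    have : ∫ y, ‖crossOp y y‖ ∂ν ≤ ∫ y, (‖C‖ + ‖crossOp y y - C‖) ∂ν := by
      refine integral_mono hS.norm ((integrable_const _).add hd) fun y => ?_
      have := norm_add_le C (crossOp y y - C)
      simpa using this
    rw [integral_add (integrable_const _) hd] at this
    simp only [integral_const, probReal_univ, one_smul] at this
    linarith
  have hN' : √(∫ y, ∑ i, ‖y i‖ ^ 2 ∂ν) ≤ t := Real.sqrt_le_iff.2 ⟨ht, hN⟩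
  have h1 : I / 2 ≤ √(a ^ 2 * (s ^ 2 + 2 * (I / 2)) + b ^ 2 * t ^ 2
      + 2 * b ^ 2 * (√(s ^ 2 + 2 * (I / 2)) * t)) := by
    have := (integral_norm_crossOp_sub_integral_le hν).trans
      (integral_norm_crossOp_add_le hν e hb hL hA hK)
    rw [div_le_iff₀' two_pos]
    refine this.trans (mul_le_mul_of_nonneg_left (Real.sqrt_le_sqrt ?_) zero_le_two)
    gcongr
  have hr0 : 0 ≤ I / 2 := by positivity
  have h2 := (Real.le_sqrt hr0 (by positivity)).1 h1
  have ha0 : 0 ≤ a := hb.trans hba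
  rcases ha0.eq_or_lt with ha | ha
  · have hb0 : b = 0 := le_antisymm (hba.trans ha.symm.le) hb
    rw [← ha, hb0] at h2
    have : (I / 2) ^ 2 ≤ 0 := by simpa using h2
    have hI' : I = 0 := by nlinarith
    rw [hI']; positivity
  · have := le_of_self_bound ha hb hs ht hr0 hba hbs h2
    linarith

/-! ### Singular factorization and counting of lags. -/

/-- A factorization of a linear map from its singular value decomposition. -/
theorem LinearMap.exists_singular_factorization {p : ℕ}
    (T : EuclideanSpace ℝ (Fin p) →ₗ[ℝ] EuclideanSpace ℝ (Fin p)) :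
    ∃ a b : Fin p → EuclideanSpace ℝ (Fin p),
      (∀ x y, inner ℝ x (T y) = ∑ k, inner ℝ (a k) x * inner ℝ (b k) y) ∧
      (∑ k, ‖a k‖ ^ 2 ≤ ∑ k : Fin p, T.singularValues k) ∧
      (∑ k, ‖b k‖ ^ 2 ≤ ∑ k : Fin p, T.singularValues k) ∧
      (∀ x, ∑ k, inner ℝ (a k) x ^ 2 ≤ ‖T.toContinuousLinearMap‖ * ‖x‖ ^ 2) ∧
      (∀ x, ∑ k, inner ℝ (b k) x ^ 2 ≤ ‖T.toContinuousLinearMap‖ * ‖x‖ ^ 2) := by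
  have hp : Module.finrank ℝ (EuclideanSpace ℝ (Fin p)) = p := by simp
  set e := T.isSymmetric_adjoint_comp_self.eigenvectorBasis hp with he
  set σ : Fin p → ℝ := fun k => T.singularValues k with hσ
  have hσ0 : ∀ k, 0 ≤ σ k := fun k => T.singularValues_nonneg k
  have hTe : ∀ j k, inner ℝ (T (e j)) (T (e k)) = if j = k then σ k ^ 2 else 0 := by
    intro j k
    have h1 := T.isSymmetric_adjoint_comp_self.apply_eigenvectorBasis hp k
    rw [← LinearMap.adjoint_inner_right]
    have h2 : (LinearMap.adjoint T) (T (e k)) = (σ k ^ 2) • e k := by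
      rw [hσ]
      simp only [T.sq_singularValues_fin hp]
      exact h1
    rw [h2, inner_smul_right, e.inner_eq_ite]
    split_ifs <;> simp
  have hTn : ∀ k, ‖T (e k)‖ = σ k := by
    intro k
    have := hTe k k
    rw [if_pos rfl, real_inner_self_eq_norm_sq] at this
    exact (pow_left_inj₀ (norm_nonneg _) (hσ0 k) two_ne_zero).1 this
  set N := ‖T.toContinuousLinearMap‖ with hN
  have hσN : ∀ k, σ k ≤ N := fun k => by
    rw [← hTn k]
    simpa using T.toContinuousLinearMap.le_opNorm (e k)
  -- Each singular value is split evenly between the two factors. If σₖ = 0 then T eₖ = 0 and the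
  -- inverse is 0 by convention, so the factor vanishes.
  set a : Fin p → EuclideanSpace ℝ (Fin p) := fun k => (√(σ k))⁻¹ • T (e k) with ha
  have hTz : ∀ k, σ k = 0 → T (e k) = 0 := fun k hk => by
    rw [← norm_eq_zero, hTn, hk]
  have haa : ∀ j k, inner ℝ (a j) (a k) = if j = k then σ k else 0 := by
    intro j k
    simp only [ha, inner_smul_left, inner_smul_right, hTe, conj_trivial]
    by_cases hjk : j = k
    · subst hjk
      rw [if_pos rfl, if_pos rfl]
      rcases (hσ0 j).eq_or_lt with h | h
      · rw [← h]; simp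
      · have h3 := Real.mul_self_sqrt h.le
        have h4 := (Real.sqrt_pos.2 h).ne'
        field_simp
        rw [sq, h3]
    · simp [hjk]
  refine ⟨a, fun k => √(σ k) • e k, fun x y => ?_, ?_, ?_, fun x => ?_, fun x => ?_⟩
  · conv_lhs => rw [← e.sum_repr' y]
    rw [map_sum, inner_sum]
    refine Finset.sum_congr rfl fun k _ => ?_
    rw [map_smul, inner_smul_right, inner_smul_left, inner_smul_left, conj_trivial, conj_trivial,
      real_inner_comm x]
    rcases (hσ0 k).eq_or_lt with h | h
    · rw [hTz k h.symm]; simp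
    · have h4 := (Real.sqrt_pos.2 h).ne'
      field_simp
  · refine Finset.sum_le_sum fun k _ => ?_
    rw [← real_inner_self_eq_norm_sq, haa, if_pos rfl]
  · refine Finset.sum_le_sum fun k _ => ?_
    rw [norm_smul, e.norm_eq_one, mul_one, Real.norm_eq_abs, sq_abs, Real.sq_sqrt (hσ0 k)]
  · set X := ∑ k, inner ℝ (a k) x • a k with hX
    set q := ∑ k, inner ℝ (a k) x ^ 2 with hq
    have hXx : inner ℝ X x = q := by
      rw [hX, sum_inner]
      exact Finset.sum_congr rfl fun k _ => by rw [inner_smul_left, conj_trivial, sq]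
    have hXX : ‖X‖ ^ 2 ≤ N * q := by
      rw [← real_inner_self_eq_norm_sq]
      conv_lhs => rw [hX]
      simp only [sum_inner, inner_sum, inner_smul_left, inner_smul_right, haa, conj_trivial,
        mul_ite, mul_zero, Finset.sum_ite_eq', Finset.mem_univ, if_true]
      rw [hq, Finset.mul_sum]
      refine Finset.sum_le_sum fun k _ => ?_
      nlinarith [hσN k, sq_nonneg (inner ℝ (a k) x)]
    have hN0 : 0 ≤ N := norm_nonneg _
    -- A Bessel-type argument for the orthogonal family a: expanding, with ⟨X, x⟩ = q and ‖X‖² ≤ Nq,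
    -- gives Nq ≤ N²‖x‖².
    have h1 : 0 ≤ ‖N • x - X‖ ^ 2 := sq_nonneg _
    rw [norm_sub_sq_real, norm_smul, inner_smul_left, real_inner_comm, hXx, conj_trivial,
      Real.norm_eq_abs, abs_of_nonneg hN0] at h1
    rcases hN0.eq_or_lt with h | h
    · have : q = 0 := by
        rw [hq]
        refine Finset.sum_eq_zero fun k _ => ?_
        have : T (e k) = 0 := hTz k (le_antisymm ((hσN k).trans h.symm.le) (hσ0 k))
        simp [ha, this]
      rw [this]; positivity
    · have : N * q ≤ N * (N * ‖x‖ ^ 2) := by nlinarith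
      exact le_of_mul_le_mul_left this h
  · rw [← e.sum_sq_inner_right, Finset.mul_sum]
    refine Finset.sum_le_sum fun k _ => ?_
    rw [inner_smul_left, conj_trivial, mul_pow, Real.sq_sqrt (hσ0 k)]
    exact mul_le_mul_of_nonneg_right (hσN k) (sq_nonneg _)

/-- From a fixed time i each lag 1, …, n − 1 occurs at most once forwards and at most once
backwards, and the missing lags contribute nonnegative terms. -/
theorem sum_range_lag_le {n i : ℕ} (hi : i < n) {f g : ℕ → ℝ} (hf : ∀ m, 0 ≤ f m)
    (hg : ∀ m, 0 ≤ g m) (d : ℝ) :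
    ∑ j ∈ Finset.range n, (if i < j then f (j - i) else if j < i then g (i - j) else d)
      ≤ d + ∑ m ∈ Finset.Icc 1 (n - 1), (f m + g m) := by
  have key : ∀ (φ : ℕ → ℕ) (h : ℕ → ℝ) (s : Finset ℕ), (∀ m, 0 ≤ h m) → Set.InjOn φ s →
      (∀ j ∈ s, φ j ∈ Finset.Icc 1 (n - 1)) →
      ∑ j ∈ s, h (φ j) ≤ ∑ m ∈ Finset.Icc 1 (n - 1), h m := by
    intro φ h s hh hinj hmem
    rw [← Finset.sum_image (f := h) hinj]
    exact Finset.sum_le_sum_of_subset_of_nonneg (Finset.image_subset_iff.2 hmem)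
      fun _ _ _ => hh _
  rw [Finset.sum_ite, Finset.sum_ite, Finset.sum_add_distrib]
  have h1 := key (fun j => j - i) f ((Finset.range n).filter fun j => i < j) hf
    (by intro x hx y hy h; simp at hx hy h; omega)
    (by intro x hx; simp at hx ⊢; omega)
  have h2 := key (fun j => i - j) g
    (((Finset.range n).filter fun j => ¬ i < j).filter fun j => j < i) hg
    (by intro x hx y hy h; simp at hx hy h; omega)
    (by intro x hx; simp at hx ⊢; omega)
  have h3 : (((Finset.range n).filter fun j => ¬ i < j).filter fun j => ¬ j < i) = {i} := by
    ext x; simp; omega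
  rw [h3, Finset.sum_const, Finset.card_singleton, one_smul]
  linarith

/-! ### Autocovariances of a stationary Gaussian sequence and their domination. -/

section Stationary

variable {Ω : Type*} [MeasurableSpace Ω] {μ : Measure Ω} {p : ℕ}
  {Y : ℤ → Ω → EuclideanSpace ℝ (Fin p)}

theorem IsStationarySeq.integral_pair_eq {E : Type*} [MeasurableSpace E] {Y : ℤ → Ω → E}
    (hstat : IsStationarySeq Y μ) {f : E × E → ℝ} (hf : Measurable f) (s t h : ℤ) :
    ∫ ω, f (Y (s + h) ω, Y (t + h) ω) ∂μ = ∫ ω, f (Y s ω, Y t ω) ∂μ := by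
  let I : Finset ℤ := {s, t}
  have hs : s ∈ I := by simp [I]
  have ht : t ∈ I := by simp [I]
  have := (hstat I h).comp (u := fun z : I → E => f (z ⟨s, hs⟩, z ⟨t, ht⟩)) (by fun_prop)
  exact this.integral_eq

variable (hgauss : IsGaussianProcess Y μ)
include hgauss

theorem IsGaussianProcess.memLp_inner (t : ℤ) (u : EuclideanSpace ℝ (Fin p)) :
    MemLp (fun ω => inner ℝ u (Y t ω)) 2 μ :=
  (hgauss.hasGaussianLaw_eval t).memLp_two.const_inner u

theorem inner_autocov (m : ℕ) (u v : EuclideanSpace ℝ (Fin p)) :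
    inner ℝ u (Matrix.toEuclideanCLM (𝕜 := ℝ) (autocov Y μ m) v)
      = ∫ ω, inner ℝ u (Y 1 ω) * inner ℝ v (Y (1 + m) ω) ∂μ := by
  have hint : ∀ i j, Integrable (fun ω => Y 1 ω i * Y (1 + (m : ℤ)) ω j) μ := fun i j => by
    have h1 := IsGaussianProcess.memLp_inner hgauss 1 (EuclideanSpace.single i 1)
    have h2 := IsGaussianProcess.memLp_inner hgauss (1 + m) (EuclideanSpace.single j 1)
    simpa [Pi.mul_def, EuclideanSpace.inner_single_left] using h1.integrable_mul h2
  have e : ∀ ω, inner ℝ u (Y 1 ω) * inner ℝ v (Y (1 + m) ω)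
      = ∑ i, ∑ j, u i * v j * (Y 1 ω i * Y (1 + (m : ℤ)) ω j) := by
    intro ω
    rw [PiLp.inner_apply, PiLp.inner_apply, Finset.sum_mul_sum]
    refine Finset.sum_congr rfl fun i _ => Finset.sum_congr rfl fun j _ => ?_
    simp; ring
  simp only [e]
  rw [integral_finsetSum _ fun i _ => integrable_finsetSum _ fun j _ => (hint i j).const_mul _]
  simp only [integral_finsetSum _ fun j _ => (hint _ j).const_mul _, integral_const_mul]
  rw [PiLp.inner_apply]
  refine Finset.sum_congr rfl fun i _ => ?_
  rw [Matrix.ofLp_toEuclideanCLM]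
  simp only [Matrix.mulVec, dotProduct, autocov, Matrix.of_apply]
  simp only [RCLike.inner_apply, conj_trivial, Finset.sum_mul]
  exact Finset.sum_congr rfl fun j _ => by ring

variable (hstat : IsStationarySeq Y μ)
include hstat

theorem integral_inner_mul_inner_eq (s : ℤ) (m : ℕ) (u v : EuclideanSpace ℝ (Fin p)) :
    ∫ ω, inner ℝ u (Y s ω) * inner ℝ v (Y (s + m) ω) ∂μ
      = inner ℝ u (Matrix.toEuclideanCLM (𝕜 := ℝ) (autocov Y μ m) v) := by
  rw [inner_autocov hgauss]
  have := hstat.integral_pair_eq (f := fun z => inner ℝ u z.1 * inner ℝ v z.2)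
    (by fun_prop) 1 (1 + m) (s - 1)
  simp only at this
  rw [← this]
  ring_nf

theorem integral_inner_sq_le (s : ℤ) (u : EuclideanSpace ℝ (Fin p)) :
    ∫ ω, inner ℝ u (Y s ω) ^ 2 ∂μ ≤ ‖autocov Y μ 0‖ * ‖u‖ ^ 2 := by
  have := integral_inner_mul_inner_eq hgauss hstat s 0 u u
  simp only [Nat.cast_zero, add_zero, ← sq] at this
  rw [this, ← Matrix.l2_opNorm_toEuclideanCLM]
  refine (real_inner_le_norm _ _).trans ?_
  have := (Matrix.toEuclideanCLM (𝕜 := ℝ) (autocov Y μ 0)).le_opNorm u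
  nlinarith [norm_nonneg u]

/-- For unit u, v, AM-GM bounds the covariance of ⟨u, Y₁⟩ and ⟨v, Y₁₊ₘ⟩ by the mean of two
variances, each at most the norm at lag zero by stationarity. -/
theorem norm_autocov_le (m : ℕ) : ‖autocov Y μ m‖ ≤ ‖autocov Y μ 0‖ := by
  rw [← Matrix.l2_opNorm_toEuclideanCLM (autocov Y μ m)]
  refine ContinuousLinearMap.opNorm_le_of_unit_norm (norm_nonneg _) fun v hv => ?_
  set w := Matrix.toEuclideanCLM (𝕜 := ℝ) (autocov Y μ m) v with hw
  have key : ∀ u, ‖u‖ = 1 → inner ℝ u w ≤ ‖autocov Y μ 0‖ := by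
    intro u hu
    have h1 := integral_inner_sq_le hgauss hstat 1 u
    have h2 := integral_inner_sq_le hgauss hstat (1 + m) v
    have i1 := (IsGaussianProcess.memLp_inner hgauss 1 u)
    have i2 := (IsGaussianProcess.memLp_inner hgauss (1 + m) v)
    rw [hw, inner_autocov hgauss]
    have h3 : ∫ ω, inner ℝ u (Y 1 ω) * inner ℝ v (Y (1 + m) ω) ∂μ
        ≤ ∫ ω, 2⁻¹ * (inner ℝ u (Y 1 ω) ^ 2 + inner ℝ v (Y (1 + m) ω) ^ 2) ∂μ := by
      refine integral_mono (i1.integrable_mul i2)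
        ((i1.integrable_sq.add i2.integrable_sq).const_mul _) fun ω => ?_
      simp only
      nlinarith [sq_nonneg (inner ℝ u (Y 1 ω) - inner ℝ v (Y (1 + m) ω))]
    rw [integral_const_mul, integral_add i1.integrable_sq i2.integrable_sq] at h3
    rw [hu] at h1; rw [hv] at h2
    linarith
  by_cases hw0 : w = 0
  · rw [hw0, norm_zero]; exact norm_nonneg _
  have hn : ‖w‖ ≠ 0 := norm_ne_zero_iff.2 hw0
  have := key (‖w‖⁻¹ • w) (by rw [norm_smul, norm_inv, norm_norm, inv_mul_cancel₀ hn])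
  rwa [inner_smul_left, real_inner_self_eq_norm_sq, conj_trivial, sq, ← mul_assoc,
    inv_mul_cancel₀ hn, one_mul] at this

end Stationary

theorem sum_fin_half_weight {n : ℕ} (hn : 1 ≤ n) (g : ℕ → ℝ) :
    ∑ m : Fin n, (if (m : ℕ) = 0 then 2⁻¹ else 1) * g m
      = 2⁻¹ * g 0 + ∑ m ∈ Finset.Icc 1 (n - 1), g m := by
  obtain ⟨k, rfl⟩ : ∃ k, n = k + 1 := ⟨n - 1, by omega⟩
  rw [Fin.sum_univ_succ]
  simp only [Fin.val_zero, if_true, Fin.val_succ, Nat.add_eq_zero_iff, one_ne_zero, and_false,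
    if_false, one_mul, Nat.add_sub_cancel]
  rw [Fin.sum_univ_eq_sum_range (fun m => g (m + 1)), Finset.range_eq_Ico,
    Finset.sum_Ico_add' g 0 k 1, zero_add]
  rfl

section Stationary

variable {Ω : Type*} [MeasurableSpace Ω] {μ : Measure Ω} {p : ℕ}
  {Y : ℤ → Ω → EuclideanSpace ℝ (Fin p)}

/-- The covariance of `(Y₁, …, Yₙ)` is dominated by a block-diagonal one whose trace and norm are
controlled by the nuclear and spectral norms of the autocovariance matrices. -/
theorem exists_dominating_vectors (hgauss : IsGaussianProcess Y μ) (hstat : IsStationarySeq Y μ)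
    {n : ℕ} (hn : 1 ≤ n) :
    ∃ c : Fin n × Bool × Fin p → EuclideanSpace ℝ (Fin p),
      (∑ j, ‖c j‖ ^ 2 ≤ nuclearNorm (autocov Y μ 0)
        + 2 * ∑ m ∈ Finset.Icc 1 (n - 1), nuclearNorm (autocov Y μ m)) ∧
      (∀ u, ∑ j, inner ℝ (c j) u ^ 2 ≤ (‖autocov Y μ 0‖
        + 2 * ∑ m ∈ Finset.Icc 1 (n - 1), ‖autocov Y μ m‖) * ‖u‖ ^ 2) ∧
      ∀ w : Fin n → EuclideanSpace ℝ (Fin p),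
        ∫ ω, (∑ i, inner ℝ (w i) (Y ((i : ℕ) + 1 : ℤ) ω)) ^ 2 ∂μ
          ≤ ∑ i, ∑ j, inner ℝ (c j) (w i) ^ 2 := by
  choose a b hab ha hb ha' hb' using fun m =>
    (Matrix.toEuclideanLin (autocov Y μ m)).exists_singular_factorization
  have hnorm : ∀ m, ‖(Matrix.toEuclideanLin (autocov Y μ m)).toContinuousLinearMap‖
      = ‖autocov Y μ m‖ := fun m => (Matrix.l2_opNorm_def _).symm
  -- At lag zero the two factor families together would count Σ₀ twice; a positive lag genuinely
  -- occurs on both sides of the diagonal.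
  let wt : ℕ → ℝ := fun m => if m = 0 then 2⁻¹ else 1
  have hwt : ∀ m, 0 ≤ wt m := fun m => by simp only [wt]; split_ifs <;> norm_num
  let c : Fin n × Bool × Fin p → EuclideanSpace ℝ (Fin p) := fun j =>
    √(wt j.1) • (if j.2.1 then a j.1 j.2.2 else b j.1 j.2.2)
  let α : ℕ → EuclideanSpace ℝ (Fin p) → ℝ := fun m x => ∑ k, inner ℝ (a m k) x ^ 2
  let β : ℕ → EuclideanSpace ℝ (Fin p) → ℝ := fun m x => ∑ k, inner ℝ (b m k) x ^ 2
  have hα : ∀ m x, 0 ≤ α m x := fun m x => Finset.sum_nonneg fun _ _ => sq_nonneg _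
  have hβ : ∀ m x, 0 ≤ β m x := fun m x => Finset.sum_nonneg fun _ _ => sq_nonneg _
  have hc : ∀ x, ∑ j, inner ℝ (c j) x ^ 2
      = 2⁻¹ * (α 0 x + β 0 x) + ∑ m ∈ Finset.Icc 1 (n - 1), (α m x + β m x) := by
    intro x
    rw [← sum_fin_half_weight hn (fun m => α m x + β m x), Fintype.sum_prod_type]
    refine Finset.sum_congr rfl fun m _ => ?_
    rw [Fintype.sum_prod_type, Fintype.sum_bool, mul_add, Finset.mul_sum, Finset.mul_sum]
    congr 1 <;> refine Finset.sum_congr rfl fun k _ => ?_ <;>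
      simp only [c, if_true, Bool.false_eq_true, if_false, inner_smul_left, conj_trivial, mul_pow,
        Real.sq_sqrt (hwt _)] <;> rfl
  refine ⟨c, ?_, fun u => ?_, fun w => ?_⟩
  · have e : ∑ j, ‖c j‖ ^ 2 = 2⁻¹ * (∑ k, ‖a 0 k‖ ^ 2 + ∑ k, ‖b 0 k‖ ^ 2)
        + ∑ m ∈ Finset.Icc 1 (n - 1), (∑ k, ‖a m k‖ ^ 2 + ∑ k, ‖b m k‖ ^ 2) := by
      rw [← sum_fin_half_weight hn (fun m => ∑ k, ‖a m k‖ ^ 2 + ∑ k, ‖b m k‖ ^ 2),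
        Fintype.sum_prod_type]
      refine Finset.sum_congr rfl fun m _ => ?_
      rw [Fintype.sum_prod_type, Fintype.sum_bool, mul_add, Finset.mul_sum, Finset.mul_sum]
      congr 1 <;> refine Finset.sum_congr rfl fun k _ => ?_ <;>
        simp only [c, if_true, Bool.false_eq_true, if_false, norm_smul, Real.norm_eq_abs, mul_pow,
          sq_abs, Real.sq_sqrt (hwt _)] <;> rfl
    rw [e, Finset.mul_sum]
    refine add_le_add ?_ (Finset.sum_le_sum fun m _ => ?_)
    · have h1 := ha 0; have h2 := hb 0
      simp only [nuclearNorm]; linarith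
    · have h1 := ha m; have h2 := hb m
      simp only [nuclearNorm]; linarith
  · rw [hc, add_mul, mul_assoc, Finset.sum_mul, Finset.mul_sum]
    refine add_le_add ?_ (Finset.sum_le_sum fun m _ => ?_)
    · have h1 := ha' 0 u; have h2 := hb' 0 u
      rw [hnorm] at h1 h2
      simp only [α, β]; linarith
    · have h1 := ha' m u; have h2 := hb' m u
      rw [hnorm] at h1 h2
      simp only [α, β]; linarith
  · have hL2 : ∀ i : Fin n, MemLp (fun ω => inner ℝ (w i) (Y ((i : ℕ) + 1 : ℤ) ω)) 2 μ :=
      fun i => IsGaussianProcess.memLp_inner hgauss _ _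
    have hlag : ∀ i j : Fin n, (i : ℕ) ≤ j →
        ∫ ω, inner ℝ (w i) (Y ((i : ℕ) + 1 : ℤ) ω) * inner ℝ (w j) (Y ((j : ℕ) + 1 : ℤ) ω) ∂μ
          ≤ 2⁻¹ * (α (j - i) (w i) + β (j - i) (w j)) := by
      intro i j hij
      have h1 := integral_inner_mul_inner_eq hgauss hstat ((i : ℕ) + 1) ((j : ℕ) - i) (w i) (w j)
      have e : ((i : ℕ) + 1 : ℤ) + (((j : ℕ) - (i : ℕ) : ℕ) : ℤ) = (j : ℕ) + 1 := by omega
      rw [e] at h1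
      rw [h1]
      have h2 := hab (j - i) (w i) (w j)
      rw [← Matrix.coe_toEuclideanCLM_eq_toEuclideanLin] at h2
      refine (le_of_eq h2).trans ?_
      rw [← Finset.sum_add_distrib, Finset.mul_sum]
      refine Finset.sum_le_sum fun k _ => ?_
      nlinarith [sq_nonneg (inner ℝ (a (j - i) k) (w i) - inner ℝ (b (j - i) k) (w j))]
    -- AM-GM splits each covariance into one part involving only w i and one only w j. ψ i j is the
    -- part charged to i: the left factor when i is the earlier time, the right factor when it is
    -- the later. Symmetrizing over (i, j) then leaves row sums.
    let ψ : Fin n → ℕ → ℝ := fun i j => if (i : ℕ) < j then α (j - i) (w i)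
      else if j < i then β (i - j) (w i) else 2⁻¹ * (α 0 (w i) + β 0 (w i))
    have hψ : ∀ i j : Fin n,
        ∫ ω, inner ℝ (w i) (Y ((i : ℕ) + 1 : ℤ) ω) * inner ℝ (w j) (Y ((j : ℕ) + 1 : ℤ) ω) ∂μ
          ≤ 2⁻¹ * (ψ i j + ψ j i) := by
      intro i j
      rcases lt_trichotomy (i : ℕ) j with h | h | h
      · have := hlag i j h.le
        simpa [ψ, h, h.not_gt] using this
      · have hij : i = j := Fin.ext h
        subst hij
        have := hlag i i le_rfl
        simp only [Nat.sub_self] at this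
        simp only [ψ, lt_irrefl, if_false]
        linarith
      · have := hlag j i h.le
        simp only [ψ, h, h.not_gt, if_true, if_false]
        simp only [mul_comm (inner ℝ (w i) _)]
        linarith
    have hsq : ∫ ω, (∑ i, inner ℝ (w i) (Y ((i : ℕ) + 1 : ℤ) ω)) ^ 2 ∂μ
        = ∑ i, ∑ j, ∫ ω, inner ℝ (w i) (Y ((i : ℕ) + 1 : ℤ) ω)
            * inner ℝ (w j) (Y ((j : ℕ) + 1 : ℤ) ω) ∂μ := by
      have hi : ∀ i j : Fin n, Integrable (fun ω => inner ℝ (w i) (Y ((i : ℕ) + 1 : ℤ) ω)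
            * inner ℝ (w j) (Y ((j : ℕ) + 1 : ℤ) ω)) μ :=
        fun i j => (hL2 i).integrable_mul (hL2 j)
      simp only [sq, Finset.sum_mul_sum]
      rw [integral_finsetSum _ fun i _ => integrable_finsetSum _ fun j _ => hi i j]
      exact Finset.sum_congr rfl fun i _ => integral_finsetSum _ fun j _ => hi i j
    calc ∫ ω, (∑ i, inner ℝ (w i) (Y ((i : ℕ) + 1 : ℤ) ω)) ^ 2 ∂μ
        ≤ ∑ i, ∑ j : Fin n, 2⁻¹ * (ψ i j + ψ j i) := by
          rw [hsq]
          exact Finset.sum_le_sum fun i _ => Finset.sum_le_sum fun j _ => hψ i j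
      _ = ∑ i, ∑ j : Fin n, ψ i j := by
          simp only [mul_add, Finset.sum_add_distrib]
          rw [Finset.sum_comm (f := fun i j : Fin n => 2⁻¹ * ψ j i), ← Finset.sum_add_distrib]
          refine Finset.sum_congr rfl fun i _ => ?_
          rw [← Finset.sum_add_distrib]
          exact Finset.sum_congr rfl fun j _ => by ring
      _ ≤ ∑ i, ∑ j, inner ℝ (c j) (w i) ^ 2 := by
          refine Finset.sum_le_sum fun i _ => ?_
          rw [hc, Fin.sum_univ_eq_sum_range (ψ i)]
          exact sum_range_lag_le i.2 (f := fun m => α m (w i)) (g := fun m => β m (w i))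
            (fun m => hα m _) (fun m => hβ m _) _

/-- Pair the image w of a unit vector with itself through the factorization; Cauchy–Schwarz and
AM-GM bound ‖w‖² by the nuclear norm times ‖w‖. It serves to give B ≤ A. -/
theorem norm_autocov_le_nuclearNorm (m : ℕ) : ‖autocov Y μ m‖ ≤ nuclearNorm (autocov Y μ m) := by
  obtain ⟨a, b, hab, ha, hb, -, -⟩ :=
    (Matrix.toEuclideanLin (autocov Y μ m)).exists_singular_factorization
  have hN0 : 0 ≤ nuclearNorm (autocov Y μ m) :=
    Finset.sum_nonneg fun _ _ => LinearMap.singularValues_nonneg _ _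
  rw [Matrix.l2_opNorm_def]
  refine ContinuousLinearMap.opNorm_le_of_unit_norm hN0 fun v hv => ?_
  set w := Matrix.toEuclideanLin (autocov Y μ m) v with hw
  have key : ‖w‖ ^ 2 ≤ nuclearNorm (autocov Y μ m) * ‖w‖ := by
    rw [← real_inner_self_eq_norm_sq]
    conv_lhs => rw [hw]
    rw [hab, ← hw]
    calc ∑ k, inner ℝ (a k) w * inner ℝ (b k) v
        ≤ ∑ k, 2⁻¹ * (‖a k‖ ^ 2 + ‖b k‖ ^ 2) * ‖w‖ := by
          refine Finset.sum_le_sum fun k _ => ?_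
          have h1 : inner ℝ (a k) w * inner ℝ (b k) v ≤ (‖a k‖ * ‖w‖) * ‖b k‖ := by
            refine (le_abs_self _).trans ?_
            rw [abs_mul]
            refine mul_le_mul (abs_real_inner_le_norm _ _) ?_ (abs_nonneg _) (by positivity)
            simpa [hv] using abs_real_inner_le_norm (b k) v
          nlinarith [mul_nonneg (sq_nonneg (‖a k‖ - ‖b k‖)) (norm_nonneg w)]
      _ = 2⁻¹ * (∑ k, ‖a k‖ ^ 2 + ∑ k, ‖b k‖ ^ 2) * ‖w‖ := by
          rw [← Finset.sum_add_distrib, Finset.mul_sum, Finset.sum_mul]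
      _ ≤ nuclearNorm (autocov Y μ m) * ‖w‖ := by
          refine mul_le_mul_of_nonneg_right ?_ (norm_nonneg _)
          simp only [nuclearNorm]; linarith
  change ‖w‖ ≤ _
  by_cases h0 : ‖w‖ = 0
  · rw [h0]; exact hN0
  · have : 0 < ‖w‖ := lt_of_le_of_ne (norm_nonneg _) (Ne.symm h0)
    exact le_of_mul_le_mul_right (by rwa [← sq]) this

end Stationary

/-! ### From the sample covariance matrix to the operator bound. -/

section Sample

variable {Ω : Type*} [MeasurableSpace Ω] {μ : Measure Ω} {p : ℕ}
  {Y : ℤ → Ω → EuclideanSpace ℝ (Fin p)}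

/-- The observations `(Y₁, …, Yₙ)` as one random vector. -/
def observations (Y : ℤ → Ω → EuclideanSpace ℝ (Fin p)) (n : ℕ) (ω : Ω) :
    Fin n → EuclideanSpace ℝ (Fin p) := fun i => Y ((i : ℕ) + 1 : ℤ) ω

theorem hasGaussianLaw_observations (hgauss : IsGaussianProcess Y μ) (n : ℕ) :
    HasGaussianLaw (observations Y n) μ := by
  have h := (hgauss.comp_right fun i : Fin n => ((i : ℕ) + 1 : ℤ)).hasGaussianLaw Finset.univ
  exact h.map_fun (ContinuousLinearMap.pi fun i : Fin n =>
    ContinuousLinearMap.proj (R := ℝ) (φ := fun _ : (Finset.univ : Finset (Fin n)) =>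
      EuclideanSpace ℝ (Fin p)) ⟨i, Finset.mem_univ i⟩)

theorem toEuclideanCLM_vecMulVec (x y : EuclideanSpace ℝ (Fin p)) :
    Matrix.toEuclideanCLM (𝕜 := ℝ) (Matrix.vecMulVec x.ofLp y.ofLp)
      = (innerSL ℝ y).smulRight x := by
  ext v i
  rw [Matrix.ofLp_toEuclideanCLM, Matrix.vecMulVec_mulVec]
  simp [PiLp.inner_apply, dotProduct, mul_comm]

theorem toEuclideanCLM_sampleAutocov {Ω : Type*} (Y : ℤ → Ω → EuclideanSpace ℝ (Fin p)) (n : ℕ)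
    (ω : Ω) :
    Matrix.toEuclideanCLM (𝕜 := ℝ) (sampleAutocov Y n 0 ω)
      = (n : ℝ)⁻¹ • crossOp (observations Y n ω) (observations Y n ω) := by
  have e : sampleAutocov Y n 0 ω = (n : ℝ)⁻¹ • ∑ i : Fin n,
      Matrix.vecMulVec (observations Y n ω i).ofLp (observations Y n ω i).ofLp := by
    rw [sampleAutocov, Nat.sub_zero, ← Finset.Ico_add_one_right_eq_Icc,
      Finset.sum_Ico_eq_sum_range, Nat.add_sub_cancel, Finset.sum_range]
    simp [observations, add_comm]
  rw [e, map_smul, map_sum, crossOp]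
  simp only [toEuclideanCLM_vecMulVec]

theorem integral_crossOp_observations (hgauss : IsGaussianProcess Y μ)
    (hstat : IsStationarySeq Y μ) (n : ℕ) :
    ∫ y, crossOp y y ∂(μ.map (observations Y n))
      = (n : ℝ) • Matrix.toEuclideanCLM (𝕜 := ℝ) (autocov Y μ 0) := by
  have hg := hasGaussianLaw_observations hgauss n
  have := hg.isGaussian_map
  have hS := integrable_crossOp_self (ν := μ.map (observations Y n))
  ext1 v
  refine ext_inner_left ℝ fun u => ?_
  rw [ContinuousLinearMap.integral_apply hS, ← integral_inner (hS.apply_continuousLinearMap v),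
    integral_map hg.aemeasurable]
  · simp only [inner_crossOp]
    rw [integral_finsetSum]
    · have h : ∀ i : Fin n, ∫ ω, inner ℝ (observations Y n ω i) v
          * inner ℝ u (observations Y n ω i) ∂μ
          = inner ℝ u (Matrix.toEuclideanCLM (𝕜 := ℝ) (autocov Y μ 0) v) := by
        intro i
        rw [← integral_inner_mul_inner_eq hgauss hstat ((i : ℕ) + 1 : ℤ) 0]
        congr 1; ext ω
        simp only [observations, Nat.cast_zero, add_zero]
        rw [real_inner_comm, mul_comm]
      simp only [h, Finset.sum_const, Finset.card_univ, Fintype.card_fin, smul_apply,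
        inner_smul_right, nsmul_eq_mul]
    · intro i _
      have h1 := IsGaussianProcess.memLp_inner hgauss ((i : ℕ) + 1 : ℤ) v
      have h2 := IsGaussianProcess.memLp_inner hgauss ((i : ℕ) + 1 : ℤ) u
      simpa [Pi.mul_def, observations, real_inner_comm] using h1.integrable_mul h2
  · exact ((hS.apply_continuousLinearMap v).const_inner u).aestronglyMeasurable

theorem integral_norm_sq_eq_trace (hgauss : IsGaussianProcess Y μ)
    (hstat : IsStationarySeq Y μ) (s : ℤ) :
    ∫ ω, ‖Y s ω‖ ^ 2 ∂μ = (autocov Y μ 0).trace := by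
  have e : ∀ ω, ‖Y s ω‖ ^ 2 = ∑ k, inner ℝ (EuclideanSpace.single k 1) (Y s ω)
      * inner ℝ (EuclideanSpace.single k 1) (Y (s + (0 : ℕ)) ω) := by
    intro ω
    rw [EuclideanSpace.real_norm_sq_eq]
    simp [EuclideanSpace.inner_single_left, sq]
  simp only [e]
  have hi : ∀ k ∈ Finset.univ, Integrable (fun ω =>
      inner ℝ (EuclideanSpace.single (k : Fin p) (1 : ℝ)) (Y s ω)
        * inner ℝ (EuclideanSpace.single k (1 : ℝ)) (Y (s + (0 : ℕ)) ω)) μ := fun k _ =>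
    (IsGaussianProcess.memLp_inner hgauss s _).integrable_mul
      (IsGaussianProcess.memLp_inner hgauss _ _)
  rw [integral_finsetSum _ hi, Matrix.trace]
  refine Finset.sum_congr rfl fun k _ => ?_
  rw [integral_inner_mul_inner_eq hgauss hstat, EuclideanSpace.inner_single_left,
    Matrix.ofLp_toEuclideanCLM]
  simp

/-- `coeffs c` as a continuous linear map. -/
noncomputable def coeffsCLM {J : Type*} [Fintype J] (c : J → EuclideanSpace ℝ (Fin p)) :
    EuclideanSpace ℝ (Fin p) →L[ℝ] EuclideanSpace ℝ J :=
  LinearMap.toContinuousLinearMap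
    { toFun := coeffs c
      map_add' := fun x y => by ext; simp [coeffs, inner_add_right]
      map_smul' := fun r x => by ext; simp [coeffs, inner_smul_right] }

theorem norm_coeffsCLM_sq {J : Type*} [Fintype J] (c : J → EuclideanSpace ℝ (Fin p))
    (x : EuclideanSpace ℝ (Fin p)) : ‖coeffsCLM c x‖ ^ 2 = ∑ j, inner ℝ (c j) x ^ 2 := by
  rw [EuclideanSpace.real_norm_sq_eq]
  rfl

end Sample

theorem mainTheorem5 {Ω : Type*} [MeasurableSpace Ω] (μ : Measure Ω) [IsProbabilityMeasure μ]
    (p n : ℕ) (hn : 1 ≤ n) (Y : ℤ → Ω → EuclideanSpace ℝ (Fin p))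
    (hgauss : IsGaussianProcess Y μ)
    (hmean : ∀ t : ℤ, ∫ ω, Y t ω ∂μ = 0)
    (hstat : IsStationarySeq Y μ) :
    Integrable (fun ω => ‖sampleAutocov Y n 0 ω - autocov Y μ 0‖) μ ∧
    ∫ ω, ‖sampleAutocov Y n 0 ω - autocov Y μ 0‖ ∂μ ≤
      (2 / (n : ℝ)) *
        (2 * (nuclearNorm (autocov Y μ 0)
              + 2 * ∑ m ∈ Finset.Icc 1 (n - 1), nuclearNorm (autocov Y μ m))
          + √(2 * (n : ℝ) * ‖autocov Y μ 0‖ *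
              (nuclearNorm (autocov Y μ 0)
                + 2 * ∑ m ∈ Finset.Icc 1 (n - 1), nuclearNorm (autocov Y μ m)))
          + √(2 * (n : ℝ) *
              (‖autocov Y μ 0‖ + 2 * ∑ m ∈ Finset.Icc 1 (n - 1), ‖autocov Y μ m‖) *
              (autocov Y μ 0).trace)) := by
  have hg := hasGaussianLaw_observations hgauss n
  have hνg := hg.isGaussian_map
  set ν := μ.map (observations Y n) with hνdef
  have hn0 : (0 : ℝ) < n := by exact_mod_cast hn
  have hS := integrable_crossOp_self (ν := ν)
  have hC := integral_crossOp_observations hgauss hstat n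
  rw [← hνdef] at hC
  set C := ∫ y, crossOp y y ∂ν with hCdef
  have hdev : ∀ ω, ‖sampleAutocov Y n 0 ω - autocov Y μ 0‖
      = (n : ℝ)⁻¹ * ‖crossOp (observations Y n ω) (observations Y n ω) - C‖ := by
    intro ω
    have h0 : Matrix.toEuclideanCLM (𝕜 := ℝ) (autocov Y μ 0) = (n : ℝ)⁻¹ • C := by
      rw [hC, inv_smul_smul₀ hn0.ne']
    rw [← Matrix.l2_opNorm_toEuclideanCLM, map_sub, toEuclideanCLM_sampleAutocov, h0]
    refine (congrArg norm (smul_sub (n : ℝ)⁻¹ _ C).symm).trans ?_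
    rw [norm_smul, Real.norm_of_nonneg (inv_nonneg.2 hn0.le)]
  have hSC : Integrable (fun y => ‖crossOp y y - C‖) ν := (hS.sub (integrable_const C)).norm
  have hSC' : Integrable (fun ω => ‖crossOp (observations Y n ω) (observations Y n ω) - C‖) μ :=
    hSC.comp_aemeasurable hg.aemeasurable
  simp only [hdev]
  refine ⟨hSC'.const_mul _, ?_⟩
  rw [integral_const_mul, ← integral_map (f := fun y => ‖crossOp y y - C‖) hg.aemeasurable
    hSC.aestronglyMeasurable, ← hνdef]
  set A := nuclearNorm (autocov Y μ 0)
    + 2 * ∑ m ∈ Finset.Icc 1 (n - 1), nuclearNorm (autocov Y μ m) with hA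
  set B := ‖autocov Y μ 0‖ + 2 * ∑ m ∈ Finset.Icc 1 (n - 1), ‖autocov Y μ m‖ with hB
  set τ := (autocov Y μ 0).trace with hτ
  have hB0 : 0 ≤ B := by positivity
  have hBA : B ≤ A := add_le_add (norm_autocov_le_nuclearNorm 0) (mul_le_mul_of_nonneg_left
    (Finset.sum_le_sum fun m _ => norm_autocov_le_nuclearNorm m) zero_le_two)
  have hA0 : 0 ≤ A := hB0.trans hBA
  have hτ0 : 0 ≤ τ := by
    rw [hτ, ← integral_norm_sq_eq_trace hgauss hstat 0]
    exact integral_nonneg fun _ => sq_nonneg _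
  -- B has 2n − 1 terms counted with multiplicity, each at most ‖Σ₀‖; this is the condition b ≤ √2 s
  -- of the scalar inequality.
  have hBs : B ≤ 2 * (n * ‖autocov Y μ 0‖) := by
    have h1 : ∑ m ∈ Finset.Icc 1 (n - 1), ‖autocov Y μ m‖ ≤ ((n : ℝ) - 1) * ‖autocov Y μ 0‖ := by
      refine (Finset.sum_le_sum fun m _ => norm_autocov_le hgauss hstat m).trans (le_of_eq ?_)
      rw [Finset.sum_const, Nat.card_Icc, nsmul_eq_mul, Nat.add_sub_cancel, Nat.cast_sub hn,
        Nat.cast_one]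
    have := norm_nonneg (autocov Y μ 0)
    rw [hB]; linarith
  -- For p = 0 there are no unit vectors for the net argument, but the deviation is zero.
  rcases subsingleton_or_nontrivial (EuclideanSpace ℝ (Fin p)) with hp | hp
  · have : ∀ y : Fin n → EuclideanSpace ℝ (Fin p), ‖crossOp y y - C‖ = 0 := fun y => by
      rw [Subsingleton.elim (crossOp y y - C) 0, norm_zero]
    simp only [this, integral_zero, mul_zero]
    positivity
  have hν : ∫ y, y ∂ν = 0 := by
    rw [hνdef, integral_map hg.aemeasurable (by fun_prop)]
    ext1 i
    have := (ContinuousLinearMap.proj (R := ℝ) (φ := fun _ : Fin n =>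
      EuclideanSpace ℝ (Fin p)) i).integral_comp_comm hg.integrable
    exact this.symm.trans (hmean _)
  obtain ⟨c, hcA, hcB, hcK⟩ := exists_dominating_vectors hgauss hstat hn
  have hA2 : √A ^ 2 = A := Real.sq_sqrt hA0
  have hB2 : √B ^ 2 = B := Real.sq_sqrt hB0
  have hs2 : √(n * ‖autocov Y μ 0‖) ^ 2 = n * ‖autocov Y μ 0‖ := Real.sq_sqrt (by positivity)
  have ht2 : √(n * τ) ^ 2 = n * τ := Real.sq_sqrt (by positivity)
  -- Here a² = A, b² = B, s² = n‖Σ₀‖ = ‖ES‖ and t² = n Tr Σ₀ = E∑‖Yᵢ‖², so the three terms of the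
  -- abstract bound become those of the theorem after division by n.
  have main := integral_norm_crossOp_sub_integral_le_of_dominated hν
    (EuclideanSpace.basisFun (Fin p) ℝ) (L := coeffsCLM c) (a := √A) (b := √B)
    (s := √(n * ‖autocov Y μ 0‖)) (t := √(n * τ)) (Real.sqrt_nonneg _) (Real.sqrt_nonneg _)
    (Real.sqrt_nonneg _) (Real.sqrt_le_sqrt hBA)
    (by rw [← Real.sqrt_mul zero_le_two]; exact Real.sqrt_le_sqrt hBs)
    (fun u => by
      refine le_of_sq_le_sq ?_ (by positivity)
      rw [norm_coeffsCLM_sq, mul_pow, hB2]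
      exact hcB u)
    (by
      rw [hA2]
      refine le_trans (le_of_eq ?_) hcA
      simp only [norm_coeffsCLM_sq]
      rw [Finset.sum_comm]
      exact Finset.sum_congr rfl fun j _ => OrthonormalBasis.sum_sq_inner_left _ _)
    (fun w => by
      rw [hνdef, integral_map hg.aemeasurable (Measurable.aestronglyMeasurable (by fun_prop))]
      simp only [norm_coeffsCLM_sq]
      exact hcK w)
    (by
      rw [← hCdef, hC, hs2, norm_smul, Matrix.l2_opNorm_toEuclideanCLM,
        Real.norm_of_nonneg hn0.le])
    (by
      rw [ht2, integral_finsetSum _ fun i _ => integrable_norm_sq_eval i]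
      have h : ∀ i : Fin n, ∫ y, ‖y i‖ ^ 2 ∂ν = τ := fun i => by
        rw [hνdef, integral_map hg.aemeasurable (Measurable.aestronglyMeasurable (by fun_prop))]
        exact integral_norm_sq_eq_trace hgauss hstat _
      simp [h])
  rw [← hCdef, hA2] at main
  have e1 : √(2 * (n : ℝ) * ‖autocov Y μ 0‖ * A) = √2 * (√A * √(n * ‖autocov Y μ 0‖)) := by
    rw [← Real.sqrt_mul hA0, ← Real.sqrt_mul zero_le_two]
    congr 1; ring
  have e2 : √(2 * (n : ℝ) * B * τ) = √2 * (√B * √(n * τ)) := by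
    rw [← Real.sqrt_mul hB0, ← Real.sqrt_mul zero_le_two]
    congr 1; ring
  rw [e1, e2, div_eq_inv_mul, mul_assoc]
  exact mul_le_mul_of_nonneg_left main (inv_nonneg.2 hn0.le)
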